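/- Let $n\in\mathbb N$ and let $p$ be a real number with $1<p<n$ and $\frac{2n}{n+2}\le p\le 2$; put $q=\frac{np}{n-p}$ and $\ell^*_p=\frac{n-p}{p-1}$. Let $K:[0,\infty)\to(0,\infty)$ be continuous on $[0,\infty)$ and $C^1$ on $(0,\infty)$, and suppose that there are constants $A,B,\ell>0$ such that $$K(r)=A+Br^{\ell}+h(r)\quad (r\ge 0),\qquad \lim_{r\to0^+}\frac{|h(r)|+r|h'(r)|}{r^{\ell}}=0 .$$ For $R>0$ consider the problem $$\operatorname{div}\bigl(\nabla u\,|\nabla u|^{p-2}\bigr)+K(|x|)\,u\,|u|^{q-2}=0\ \text{ and }\ u>0\ \text{ for } |x|<R,\qquad u=0\ \text{ for } |x|=R, \tag{$P_R$}$$ where $x\in\mathbb R^n$. A radial solution of $(P_R)$ is a radial function $u$ that is continuous on the closed ball $\{|x|\le R\}$ and $C^1$ on the open ball $\{|x|<R\}$, such that $\nabla u\,|\nabla u|^{p-2}$ (read as $0$ where $\nabla u=0$) is differentiable on the open ball and $(P_R)$ holds pointwise. (i) If $\ell<\ell^*_p$, then $(P_R)$ has a radial solution for every $R>0$. (ii)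 If $\ell\ge\ell^*_p$, then there is $R_0>0$ such that $(P_R)$ has no radial solution for any $0<R<R_0$. -/

import Mathlib

open Set Filter Topology

noncomputable section

namespace PLaplace

/-- The divergence `∑ i, ∂ᵢ Vᵢ` of a vector field on `ℝⁿ`. -/
def divergence {n : ℕ} (V : EuclideanSpace ℝ (Fin n) → EuclideanSpace ℝ (Fin n))
    (x : EuclideanSpace ℝ (Fin n)) : ℝ :=
  ∑ i : Fin n, fderiv ℝ V x (EuclideanSpace.single i 1) i

/-- The vector field `∇u |∇u|^{p-2}`, equal to `0` where `∇u = 0`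
(the factor `∇u` makes the value of the real power at `0` irrelevant). -/
def flux {n : ℕ} (p : ℝ) (u : EuclideanSpace ℝ (Fin n) → ℝ)
    (x : EuclideanSpace ℝ (Fin n)) : EuclideanSpace ℝ (Fin n) :=
  ‖gradient u x‖ ^ (p - 2) • gradient u x

/-- The `p`-Laplace operator `div (∇u |∇u|^{p-2})`. -/
def pLaplacian {n : ℕ} (p : ℝ) (u : EuclideanSpace ℝ (Fin n) → ℝ)
    (x : EuclideanSpace ℝ (Fin n)) : ℝ :=
  divergence (flux p u) x

/-- The critical Sobolev exponent `np / (n - p)`. -/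
def critExp (n : ℕ) (p : ℝ) : ℝ := n * p / (n - p)

/-- The threshold `(n - p) / (p - 1)` for the order of flatness. -/
def flatThreshold (n : ℕ) (p : ℝ) : ℝ := (n - p) / (p - 1)

/-- `K : [0,∞) → (0,∞)` is continuous, and continuously differentiable on `(0,∞)`.
Only the values of `K` on `[0,∞)` matter. Differentiability at the endpoint `0` is not
imposed, since it would exclude all orders of flatness `ℓ < 1`. -/
structure Admissible (K : ℝ → ℝ) : Prop where
  pos : ∀ r, 0 ≤ r → 0 < K r
  cont : ContinuousOn K (Ici 0)
  contDiff : ContDiffOn ℝ 1 K (Ioi 0)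

/-- `K(r) = A + B r^ℓ + h(r)` with `A, B, ℓ > 0` and
`(|h(r)| + r |h'(r)|) / r^ℓ → 0` as `r → 0⁺`. -/
def HasFlatness (K : ℝ → ℝ) (ℓ : ℝ) : Prop :=
  0 < ℓ ∧ ∃ A B : ℝ, 0 < A ∧ 0 < B ∧ ∃ h : ℝ → ℝ,
    (∀ r, 0 ≤ r → K r = A + B * r ^ ℓ + h r) ∧
    Tendsto (fun r => (|h r| + r * |deriv h r|) / r ^ ℓ) (𝓝[>] 0) (𝓝 0)

/-- `u` is a positive radial solution of the critical Dirichlet problem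
`Δ_p u + K(|x|) u |u|^{q-2} = 0` in `|x| < R`, `u > 0` in `|x| < R`, `u = 0` on `|x| = R`.
The equation is understood classically: `u` is `C¹` and `∇u |∇u|^{p-2}` is differentiable
in the open ball (including the centre), and `u` is continuous on the closed ball. -/
structure IsPosRadialSolution (n : ℕ) (p : ℝ) (K : ℝ → ℝ) (R : ℝ)
    (u : EuclideanSpace ℝ (Fin n) → ℝ) : Prop where
  radial : ∀ x ∈ Metric.closedBall (0 : EuclideanSpace ℝ (Fin n)) R,
    ∀ y ∈ Metric.closedBall (0 : EuclideanSpace ℝ (Fin n)) R, ‖x‖ = ‖y‖ → u x = u y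
  cont : ContinuousOn u (Metric.closedBall 0 R)
  contDiff : ContDiffOn ℝ 1 u (Metric.ball 0 R)
  flux_diff : DifferentiableOn ℝ (flux p u) (Metric.ball 0 R)
  eqn : ∀ x ∈ Metric.ball (0 : EuclideanSpace ℝ (Fin n)) R,
    pLaplacian p u x + K ‖x‖ * (u x * |u x| ^ (critExp n p - 2)) = 0
  pos : ∀ x ∈ Metric.ball (0 : EuclideanSpace ℝ (Fin n)) R, 0 < u x
  boundary : ∀ x ∈ Metric.sphere (0 : EuclideanSpace ℝ (Fin n)) R, u x = 0

end PLaplace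

end

open Set Filter Topology

noncomputable section

namespace PLaplace

/-! Write σ = 1/(p-1), α = p/(n-p), q = np/(n-p), ℓ* = (n-p)/(p-1). A radial solution is described
by U and b with |U'|^(p-1) = r b and (r^n b)' = r^(n-1) K U^(q-1), and is labelled by its central
value d = U(0).

Everything rests on the Pohozaev function P (`pohozaev`). At the critical exponent P' = r^n K' U^q /
q and P(0⁺) = 0, so P is nonnegative and nondecreasing near the origin, where K' is comparable to
r^(ℓ-1). The derivative of b U^(-β), β = q(1-1/p), is a positive multiple of P (`quotient_deriv`),
so b dominates a multiple of d^α U^β; integrating the equation for U puts U below an explicit bubble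
(`bubble_bound`), which lives on the scale d^(-α) and has size d^(-σ) at a fixed distance.

The threshold comes from comparing powers of d. The core r ≤ κ d^(-α) contributes at least a
multiple of d^(-αℓ) to P (`pohozaev_ge`), the terms of P at a fixed radius have order d^(-(σ+1)),
and αℓ* = σ+1. If ℓ < ℓ*, the core wins: for large d no profile stays positive on a fixed interval
(`eventually_not_radialProfile`). So U(R) ≤ 0 for some large d, U(R) > 0 for small d, and continuity
in d gives a solution on the ball of radius R.

If ℓ ≥ ℓ*, integrating P' against the bubble gives P ≤ C d^(-(σ+1)) for every d (`pohozaev_le`). At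
a zero R of U only (1-1/p) R^n (R b)^(σ+1) survives in P, and the flux leaving the core (`w_ge`)
makes it at least a multiple of R^(-ℓ*) d^(-(σ+1)). The powers of d cancel and R is bounded below
(`exists_radius_le_of_tendsto_zero`).

The bounds 2n/(n+2) ≤ p ≤ 2 mean q ≥ 2 and σ ≥ 1. They enter only the existence half, where they
make the truncated nonlinearities Lipschitz and u of class C¹ at the centre. -/

/-! ### Monotonicity tools and the first order radial system -/

theorem le_of_deriv_nonneg_of_tendsto {F F' : ℝ → ℝ} {r c : ℝ} (hr : 0 < r)
    (hF : ∀ t ∈ Ioc 0 r, HasDerivAt F (F' t) t) (h0 : ∀ t ∈ Ioo 0 r, 0 ≤ F' t)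
    (hc : Tendsto F (𝓝[>] 0) (𝓝 c)) : c ≤ F r := by
  have hmono : MonotoneOn F (Ioc 0 r) := by
    apply monotoneOn_of_deriv_nonneg (convex_Ioc 0 r)
    · exact fun t ht => (hF t ht).continuousAt.continuousWithinAt
    · rw [interior_Ioc]
      exact fun t ht => (hF t (Ioo_subset_Ioc_self ht)).differentiableAt.differentiableWithinAt
    · rw [interior_Ioc]
      intro t ht
      rw [(hF t (Ioo_subset_Ioc_self ht)).deriv]
      exact h0 t ht
  refine le_of_tendsto hc ?_
  filter_upwards [Ioo_mem_nhdsGT hr] with t ht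
  exact hmono (Ioo_subset_Ioc_self ht) ⟨hr, le_rfl⟩ ht.2.le

theorem monotoneOn_Ioo_of_hasDerivAt {F F' : ℝ → ℝ} {R : ℝ}
    (hF : ∀ t ∈ Ioo 0 R, HasDerivAt F (F' t) t) (h0 : ∀ t ∈ Ioo 0 R, 0 ≤ F' t) :
    MonotoneOn F (Ioo 0 R) := by
  apply monotoneOn_of_deriv_nonneg (convex_Ioo 0 R)
  · exact fun t ht => (hF t ht).continuousAt.continuousWithinAt
  · rw [interior_Ioo]
    exact fun t ht => (hF t ht).differentiableAt.differentiableWithinAt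
  · rw [interior_Ioo]
    intro t ht
    rw [(hF t ht).deriv]
    exact h0 t ht

/-- A positive solution `U` of the radial equation on `(0, R)` with `U(0⁺) = d`, written as a
first order system for `U` and `b`, where `|U'|^{p-1} = r b(r)`. -/
structure RadialProfile (n : ℕ) (p : ℝ) (K : ℝ → ℝ) (R d : ℝ) (U b : ℝ → ℝ) : Prop where
  U_tendsto : Tendsto U (𝓝[>] 0) (𝓝 d)
  w_tendsto : Tendsto (fun r => r ^ n * b r) (𝓝[>] 0) (𝓝 0)
  U_pos : ∀ r ∈ Ioo 0 R, 0 < U r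
  U_deriv : ∀ r ∈ Ioo 0 R, HasDerivAt U (-(r * b r) ^ (1 / (p - 1))) r
  b_deriv : ∀ r ∈ Ioo 0 R, HasDerivAt b ((K r * U r ^ (critExp n p - 1) - n * b r) / r) r

/-- The integrating factor `r ^ n` absorbs the linear term; `t ^ n * b t` is, up to a constant, the
flux through the sphere of radius `t`. -/
theorem hasDerivAt_pow_mul {n : ℕ} {b : ℝ → ℝ} {g r : ℝ} (hr : 0 < r)
    (hb : HasDerivAt b ((g - n * b r) / r) r) :
    HasDerivAt (fun t => t ^ n * b t) (r ^ n / r * g) r := by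
  have h := (hasDerivAt_pow n r).mul hb
  refine h.congr_deriv ?_
  rcases n with _ | n
  · simp; field_simp
  · simp only [Nat.add_sub_cancel]
    push_cast
    field_simp
    ring

/-- The flux starts at 0 and strictly increases. No equation for U is involved, since for a given
radial solution the sign of U' is itself deduced from this. -/
theorem pos_of_pow_mul_tendsto_zero {n : ℕ} {b g : ℝ → ℝ} {R : ℝ}
    (hb : ∀ r ∈ Ioo 0 R, HasDerivAt b ((g r - n * b r) / r) r) (hg : ∀ r ∈ Ioo 0 R, 0 < g r)
    (h0 : Tendsto (fun r => r ^ n * b r) (𝓝[>] 0) (𝓝 0)) {r : ℝ} (hr : r ∈ Ioo 0 R) :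
    0 < b r := by
  have hw := fun t (ht : t ∈ Ioo 0 R) => hasDerivAt_pow_mul ht.1 (hb t ht)
  have hs : StrictMonoOn (fun t => t ^ n * b t) (Ioo 0 R) := by
    apply strictMonoOn_of_deriv_pos (convex_Ioo 0 R)
    · exact fun t ht => (hw t ht).continuousAt.continuousWithinAt
    · rw [interior_Ioo]
      intro t ht
      rw [(hw t ht).deriv]
      have := hg t ht
      have := ht.1
      positivity
  have h2 : r / 2 ∈ Ioo 0 R := ⟨by linarith [hr.1], by linarith [hr.1, hr.2]⟩
  have h3 := hs h2 hr (by linarith [hr.1])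
  have h4 : 0 ≤ (fun t => t ^ n * b t) (r / 2) := by
    refine le_of_deriv_nonneg_of_tendsto (F := fun t => t ^ n * b t) h2.1
      (F' := fun r => r ^ n / r * g r) ?_ ?_ h0
    · exact fun t ht => hw t ⟨ht.1, ht.2.trans_lt h2.2⟩
    · intro t ht
      have := hg t ⟨ht.1, ht.2.trans h2.2⟩
      have := ht.1
      positivity
  exact pos_of_mul_pos_right (h4.trans_lt h3) (pow_nonneg hr.1.le n)

/-! ### Elementary bounds on a profile -/

namespace RadialProfile

variable {n : ℕ} {p : ℝ} {K : ℝ → ℝ} {R d : ℝ} {U b : ℝ → ℝ}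

theorem mono (h : RadialProfile n p K R d U b) {R' : ℝ} (hR : R' ≤ R) :
    RadialProfile n p K R' d U b where
  U_tendsto := h.U_tendsto
  w_tendsto := h.w_tendsto
  U_pos := fun r hr => h.U_pos r ⟨hr.1, hr.2.trans_le hR⟩
  U_deriv := fun r hr => h.U_deriv r ⟨hr.1, hr.2.trans_le hR⟩
  b_deriv := fun r hr => h.b_deriv r ⟨hr.1, hr.2.trans_le hR⟩

theorem w_deriv (h : RadialProfile n p K R d U b) {r : ℝ} (hr : r ∈ Ioo 0 R) :
    HasDerivAt (fun t => t ^ n * b t) (r ^ n / r * (K r * U r ^ (critExp n p - 1))) r :=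
  hasDerivAt_pow_mul hr.1 (h.b_deriv r hr)

theorem w_mono (h : RadialProfile n p K R d U b) (hK : ∀ r ∈ Ioo 0 R, 0 < K r) :
    MonotoneOn (fun t => t ^ n * b t) (Ioo 0 R) := by
  refine monotoneOn_Ioo_of_hasDerivAt (fun t ht => h.w_deriv ht) fun t ht => ?_
  have := hK t ht
  have := h.U_pos t ht
  have := ht.1
  positivity

theorem b_pos (h : RadialProfile n p K R d U b) (hK : ∀ r ∈ Ioo 0 R, 0 < K r) {r : ℝ}
    (hr : r ∈ Ioo 0 R) : 0 < b r :=
  pos_of_pow_mul_tendsto_zero h.b_deriv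
    (fun t ht => mul_pos (hK t ht) (Real.rpow_pos_of_pos (h.U_pos t ht) _)) h.w_tendsto hr

theorem rb_nonneg (h : RadialProfile n p K R d U b) (hK : ∀ r ∈ Ioo 0 R, 0 < K r) {r : ℝ}
    (hr : r ∈ Ioo 0 R) : 0 ≤ r * b r := (mul_pos hr.1 (h.b_pos hK hr)).le

theorem U_antitone (h : RadialProfile n p K R d U b) (hK : ∀ r ∈ Ioo 0 R, 0 < K r) :
    AntitoneOn U (Ioo 0 R) := by
  have : MonotoneOn (fun t => - U t) (Ioo 0 R) := by
    refine monotoneOn_Ioo_of_hasDerivAt (fun t ht => (h.U_deriv t ht).neg) fun t ht => ?_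
    rw [neg_neg]
    exact Real.rpow_nonneg (h.rb_nonneg hK ht) _
  exact fun x hx y hy hxy => neg_le_neg_iff.1 (this hx hy hxy)

theorem U_le (h : RadialProfile n p K R d U b) (hK : ∀ r ∈ Ioo 0 R, 0 < K r) {r : ℝ}
    (hr : r ∈ Ioo 0 R) : U r ≤ d := by
  refine ge_of_tendsto h.U_tendsto ?_
  filter_upwards [Ioo_mem_nhdsGT hr.1] with t ht
  exact h.U_antitone hK ⟨ht.1, ht.2.trans hr.2⟩ hr ht.2.le

theorem d_pos (h : RadialProfile n p K R d U b) (hK : ∀ r ∈ Ioo 0 R, 0 < K r) (hR : 0 < R) :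
    0 < d := by
  have hr : R / 2 ∈ Ioo 0 R := ⟨by linarith, by linarith⟩
  exact (h.U_pos _ hr).trans_le (h.U_le hK hr)

theorem tendsto_pow_mul_sub (h : RadialProfile n p K R d U b) (hn : n ≠ 0) (c : ℝ) :
    Tendsto (fun r => r ^ n * (b r - c)) (𝓝[>] 0) (𝓝 0) := by
  have h1 : Tendsto (fun r : ℝ => r ^ n * c) (𝓝[>] 0) (𝓝 0) := by
    have : Tendsto (fun r : ℝ => r ^ n * c) (𝓝 0) (𝓝 (0 ^ n * c)) :=
      Continuous.tendsto (by fun_prop) 0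
    rw [zero_pow hn, zero_mul] at this
    exact this.mono_left nhdsWithin_le_nhds
  simpa [mul_sub] using h.w_tendsto.sub h1

/-- Bounding b by a constant c reduces to the sign of K U^(q-1) - n c: both `b_le` and `b_ge`
integrate this from 0, using U(r) ≤ U(t) ≤ d for t ≤ r. -/
theorem b_sub_deriv (h : RadialProfile n p K R d U b) (c : ℝ) {r : ℝ} (hr : r ∈ Ioo 0 R) :
    HasDerivAt (fun t => t ^ n * (b t - c))
      (r ^ n / r * (K r * U r ^ (critExp n p - 1) - n * c)) r := by
  refine hasDerivAt_pow_mul (b := fun t => b t - c) hr.1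
    (((h.b_deriv r hr).sub_const c).congr_deriv ?_)
  ring

theorem b_le (h : RadialProfile n p K R d U b) (hn : n ≠ 0) (hq : 1 ≤ critExp n p)
    (hK : ∀ r ∈ Ioo 0 R, 0 < K r) {M : ℝ} (hM : ∀ r ∈ Ioo 0 R, K r ≤ M) {r : ℝ}
    (hr : r ∈ Ioo 0 R) : b r ≤ M * d ^ (critExp n p - 1) / n := by
  have hn' : (0 : ℝ) < n := by positivity
  set c := M * d ^ (critExp n p - 1) / n with hc
  have key : 0 ≤ - (r ^ n * (b r - c)) := by
    refine le_of_deriv_nonneg_of_tendsto hr.1 (F := fun r => - (r ^ n * (b r - c)))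
      (fun t ht => (h.b_sub_deriv c ⟨ht.1, ht.2.trans_lt hr.2⟩).neg) ?_
      (by simpa using (h.tendsto_pow_mul_sub hn c).neg)
    intro t ht
    have ht' : t ∈ Ioo 0 R := ⟨ht.1, ht.2.trans hr.2⟩
    have h1 : K t * U t ^ (critExp n p - 1) ≤ M * d ^ (critExp n p - 1) := by
      have := hK t ht'
      have := h.U_pos t ht'
      exact mul_le_mul (hM t ht') (Real.rpow_le_rpow (h.U_pos t ht').le (h.U_le hK ht')
        (by linarith)) (by positivity) (by linarith [hM t ht'])
    have h2 : (n : ℝ) * c = M * d ^ (critExp n p - 1) := by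
      rw [hc]; field_simp
    have h3 : 0 < t ^ n / t := by have := ht.1; positivity
    rw [h2]
    nlinarith
  have h4 : 0 < r ^ n := by have := hr.1; positivity
  nlinarith

theorem b_ge (h : RadialProfile n p K R d U b) (hn : n ≠ 0) (hq : 1 ≤ critExp n p)
    {A : ℝ} (hA : 0 < A) (hK : ∀ r ∈ Ioo 0 R, A ≤ K r) {r : ℝ}
    (hr : r ∈ Ioo 0 R) : A * U r ^ (critExp n p - 1) / n ≤ b r := by
  have hn' : (0 : ℝ) < n := by positivity
  have hK' : ∀ r ∈ Ioo 0 R, 0 < K r := fun r hr => hA.trans_le (hK r hr)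
  set c := A * U r ^ (critExp n p - 1) / n with hc
  have key : 0 ≤ r ^ n * (b r - c) := by
    refine le_of_deriv_nonneg_of_tendsto hr.1 (F := fun r => r ^ n * (b r - c))
      (fun t ht => h.b_sub_deriv c ⟨ht.1, ht.2.trans_lt hr.2⟩) ?_ (h.tendsto_pow_mul_sub hn c)
    intro t ht
    have ht' : t ∈ Ioo 0 R := ⟨ht.1, ht.2.trans hr.2⟩
    have h1 : A * U r ^ (critExp n p - 1) ≤ K t * U t ^ (critExp n p - 1) := by
      have := h.U_pos r hr
      exact mul_le_mul (hK t ht') (Real.rpow_le_rpow (h.U_pos r hr).le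
        (h.U_antitone hK' ht' hr ht.2.le) (by linarith)) (by positivity) (hK' t ht').le
    have h2 : (n : ℝ) * c = A * U r ^ (critExp n p - 1) := by
      rw [hc]; field_simp
    have h3 : 0 < t ^ n / t := by have := ht.1; positivity
    rw [h2]
    exact mul_nonneg h3.le (by linarith)
  have h4 : 0 < r ^ n := by have := hr.1; positivity
  nlinarith

/-- Elementary lower bound for `U` near the centre. -/
theorem U_ge (h : RadialProfile n p K R d U b) (hn : n ≠ 0) (hq : 1 ≤ critExp n p)
    (hp : 1 < p) (hK : ∀ r ∈ Ioo 0 R, 0 < K r) {M : ℝ} (hM : ∀ r ∈ Ioo 0 R, K r ≤ M) {r : ℝ}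
    (hr : r ∈ Ioo 0 R) :
    d - (M * d ^ (critExp n p - 1) / n) ^ (1 / (p - 1)) * r ^ (1 / (p - 1) + 1) ≤ U r := by
  have hσ : 0 < 1 / (p - 1) := by have : 0 < p - 1 := by linarith
                                  positivity
  set σ := 1 / (p - 1) with hσdef
  set c := M * d ^ (critExp n p - 1) / n with hc
  have hc0 : 0 ≤ c := (h.b_pos hK hr).le.trans (h.b_le hn hq hK hM hr)
  have key : d ≤ U r + c ^ σ * r ^ (σ + 1) := by
    refine le_of_deriv_nonneg_of_tendsto hr.1 (F := fun r => U r + c ^ σ * r ^ (σ + 1))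
      (F' := fun t => -(t * b t) ^ σ + c ^ σ * ((σ + 1) * t ^ σ)) ?_ ?_ ?_
    · intro t ht
      have := (Real.hasDerivAt_rpow_const (x := t) (p := σ + 1) (Or.inl ht.1.ne')).const_mul (c ^ σ)
      rw [add_sub_cancel_right] at this
      exact (h.U_deriv t ⟨ht.1, ht.2.trans_lt hr.2⟩).add this
    · intro t ht
      have ht' : t ∈ Ioo 0 R := ⟨ht.1, ht.2.trans hr.2⟩
      have h1 : (t * b t) ^ σ ≤ (t * c) ^ σ :=
        Real.rpow_le_rpow (h.rb_nonneg hK ht')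
          (mul_le_mul_of_nonneg_left (h.b_le hn hq hK hM ht') ht.1.le) hσ.le
      rw [Real.mul_rpow ht.1.le hc0] at h1
      have h2 : 0 ≤ c ^ σ * t ^ σ := mul_nonneg (Real.rpow_nonneg hc0 _)
        (Real.rpow_nonneg ht.1.le _)
      nlinarith
    · have : Tendsto (fun r : ℝ => c ^ σ * r ^ (σ + 1)) (𝓝[>] 0) (𝓝 0) := by
        have h1 : Tendsto (fun r : ℝ => c ^ σ * r ^ (σ + 1)) (𝓝 0) (𝓝 (c ^ σ * 0 ^ (σ + 1))) :=
          ((Real.continuousAt_rpow_const 0 (σ + 1) (Or.inr (by linarith))).const_mul _).tendsto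
        rw [Real.zero_rpow (by linarith), mul_zero] at h1
        exact h1.mono_left nhdsWithin_le_nhds
      simpa using h.U_tendsto.add this
  linarith

end RadialProfile

/-! ### The Pohozaev function and comparison with the bubble -/

theorem critExp_pos {n : ℕ} {p : ℝ} (hp : 1 < p) (hpn : p < n) : 0 < critExp n p := by
  unfold critExp
  have : 0 < (n : ℝ) - p := by linarith
  have : (0 : ℝ) < n := by linarith
  positivity

theorem critExp_eq {n : ℕ} {p : ℝ} : critExp n p = n * (p / (n - p)) := by
  unfold critExp; ring

theorem lt_critExp {n : ℕ} {p : ℝ} (hp : 1 < p) (hpn : p < n) : p < critExp n p := by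
  unfold critExp
  rw [lt_div_iff₀ (by linarith)]
  nlinarith

theorem natCast_div_critExp {n : ℕ} {p : ℝ} (hp : 1 < p) (hpn : p < n) :
    (n : ℝ) / critExp n p = n * (1 / p) - 1 := by
  unfold critExp
  have : (n : ℝ) - p ≠ 0 := by linarith
  have : (n : ℝ) ≠ 0 := by linarith
  field_simp

/-- The Pohozaev function of a radial profile. -/
def pohozaev (n : ℕ) (p : ℝ) (K U b : ℝ → ℝ) (r : ℝ) : ℝ :=
  r ^ n * ((1 - 1 / p) * (r * b r) ^ (1 / (p - 1) + 1) + K r * U r ^ critExp n p / critExp n p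
    - n / critExp n p * (U r * b r))

namespace RadialProfile

variable {n : ℕ} {p : ℝ} {K : ℝ → ℝ} {R d : ℝ} {U b : ℝ → ℝ}

/-- Criticality enters as n/q = n/p - 1; together with (1 - 1/p)(σ + 1) = 1 it cancels every term
that does not contain K'. -/
theorem pohozaev_deriv (h : RadialProfile n p K R d U b) (hp : 1 < p) (hpn : p < n)
    (hK : ∀ r ∈ Ioo 0 R, 0 < K r) {r K' : ℝ} (hr : r ∈ Ioo 0 R) (hK' : HasDerivAt K K' r) :
    HasDerivAt (pohozaev n p K U b) (r ^ n * K' * U r ^ critExp n p / critExp n p) r := by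
  have hq := critExp_pos hp hpn
  have hnq := natCast_div_critExp hp hpn
  set q := critExp n p with hqdef
  have hU := h.U_pos r hr
  have hb := h.b_pos hK hr
  have hr0 : r ≠ 0 := hr.1.ne'
  have ha : r * b r ≠ 0 := by positivity
  have hUd := h.U_deriv r hr
  have hbd := h.b_deriv r hr
  rw [← hqdef] at hbd
  set σ := 1 / (p - 1) with hσ
  have hσp : (1 - 1 / p) * (σ + 1) = 1 := by
    rw [hσ]; have : p - 1 ≠ 0 := by linarith
    have : p ≠ 0 := by linarith
    field_simp; ring
  have h1 : HasDerivAt (fun t => (t * b t) ^ (σ + 1)) ((b r + (K r * U r ^ (q - 1) - n * b r))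
      * (σ + 1) * (r * b r) ^ σ) r := by
    have := ((hasDerivAt_id r).mul hbd).rpow_const (p := σ + 1) (Or.inl ha)
    refine this.congr_deriv ?_
    simp only [add_sub_cancel_right, id, Pi.mul_apply]
    field_simp
  have h2 : HasDerivAt (fun t => U t ^ q) (-(r * b r) ^ σ * q * U r ^ (q - 1)) r :=
    hUd.rpow_const (Or.inl hU.ne')
  have h3 := (hasDerivAt_pow n r).mul (((h1.const_mul (1 - 1 / p)).add
    ((hK'.mul h2).div_const q)).sub ((hUd.mul hbd).const_mul (n / q)))
  refine h3.congr_deriv ?_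
  have e1 : (n : ℝ) * r ^ (n - 1) = n * r ^ n / r := by
    have : n ≠ 0 := by rintro rfl; simp at hpn; linarith
    obtain ⟨m, rfl⟩ := Nat.exists_eq_succ_of_ne_zero this
    simp only [Nat.succ_eq_add_one, Nat.add_sub_cancel]
    field_simp
    ring
  have e2 : (r * b r) ^ (σ + 1) = r * b r * (r * b r) ^ σ := by
    rw [Real.rpow_add_one ha]; ring
  have e3 : U r ^ q = U r * U r ^ (q - 1) := by
    rw [Real.rpow_sub_one hU.ne']; field_simp
  simp only [Pi.add_apply, Pi.sub_apply, Pi.mul_apply]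
  rw [e1, e2, e3, hnq]
  -- The two powers are now free variables, and what remains is a rational identity.
  generalize (r * b r) ^ σ = s
  generalize U r ^ (q - 1) = v
  have hnq' : (n : ℝ) * q⁻¹ = n * p⁻¹ - 1 := by simpa [div_eq_mul_inv] using hnq
  have hσp' : (1 - p⁻¹) * (σ + 1) = 1 := by simpa using hσp
  have hrr : r * r⁻¹ = 1 := mul_inv_cancel₀ hr0
  have hqq : q * q⁻¹ = 1 := mul_inv_cancel₀ hq.ne'
  simp only [div_eq_mul_inv, one_mul]
  linear_combination (r ^ n * s * (b r + (K r * v - n * b r))) * hσp' +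
    (r ^ n * r⁻¹ * K r * v * U r) * hnq' + (n * r ^ n * (1 - p⁻¹) * b r * s) * hrr
    - (r ^ n * K r * s * v) * hqq

/-- The bracket in P stays bounded near the centre, while the prefactor r^n tends to 0. -/
theorem pohozaev_tendsto (h : RadialProfile n p K R d U b) (hp : 1 < p) (hpn : p < n)
    (hR : 0 < R) (hK : ∀ r ∈ Ioo 0 R, 0 < K r) {M : ℝ} (hM : ∀ r ∈ Ioo 0 R, K r ≤ M) :
    Tendsto (pohozaev n p K U b) (𝓝[>] 0) (𝓝 0) := by
  have hq := critExp_pos hp hpn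
  have hq1 : 1 ≤ critExp n p := (hp.trans (lt_critExp hp hpn)).le
  have hn : n ≠ 0 := by rintro rfl; simp at hpn; linarith
  have hd := h.d_pos hK hR
  have hM0 : 0 < M := (hK (R / 2) ⟨by linarith, by linarith⟩).trans_le
    (hM (R / 2) ⟨by linarith, by linarith⟩)
  have hσ : 0 < 1 / (p - 1) := by have : 0 < p - 1 := by linarith
                                  positivity
  have hp' : 0 < 1 - 1 / p := by
    have : 1 / p < 1 := by rw [div_lt_one (by linarith)]; exact hp
    linarith
  set c := M * d ^ (critExp n p - 1) / n with hc
  have hc0 : 0 ≤ c := by positivity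
  set C := (1 - 1 / p) * (R * c) ^ (1 / (p - 1) + 1) + M * d ^ critExp n p / critExp n p
    + n / critExp n p * (d * c) with hC
  have hlim : Tendsto (fun r : ℝ => r ^ n * C) (𝓝[>] 0) (𝓝 0) := by
    have : Tendsto (fun r : ℝ => r ^ n * C) (𝓝 0) (𝓝 (0 ^ n * C)) :=
      Continuous.tendsto (by fun_prop) 0
    rw [zero_pow hn, zero_mul] at this
    exact this.mono_left nhdsWithin_le_nhds
  refine squeeze_zero_norm' ?_ hlim
  filter_upwards [Ioo_mem_nhdsGT hR] with r hr
  have hb := h.b_pos hK hr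
  have hU := h.U_pos r hr
  have hbc := h.b_le hn hq1 hK hM hr
  have hUd := h.U_le hK hr
  have hKr := hK r hr
  have hr0 := hr.1
  unfold pohozaev
  rw [norm_mul, norm_pow, Real.norm_of_nonneg hr0.le, Real.norm_eq_abs]
  gcongr
  have t1 : (1 - 1 / p) * (r * b r) ^ (1 / (p - 1) + 1) ≤
      (1 - 1 / p) * (R * c) ^ (1 / (p - 1) + 1) := by
    gcongr; exact hr.2.le
  have t2 : K r * U r ^ critExp n p / critExp n p ≤ M * d ^ critExp n p / critExp n p := by
    gcongr; exact hM r hr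
  have t3 : n / critExp n p * (U r * b r) ≤ n / critExp n p * (d * c) := by
    gcongr
  have s1 : 0 ≤ (1 - 1 / p) * (r * b r) ^ (1 / (p - 1) + 1) := by positivity
  have s2 : 0 ≤ K r * U r ^ critExp n p / critExp n p := by positivity
  have s3 : 0 ≤ n / critExp n p * (U r * b r) := by positivity
  rw [abs_le]
  constructor <;> linarith

theorem pohozaev_nonneg (h : RadialProfile n p K R d U b) (hp : 1 < p) (hpn : p < n)
    (hK : ∀ r ∈ Ioo 0 R, 0 < K r) {M : ℝ} (hM : ∀ r ∈ Ioo 0 R, K r ≤ M)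
    (hKd : ∀ r ∈ Ioo 0 R, DifferentiableAt ℝ K r) (hKm : ∀ r ∈ Ioo 0 R, 0 ≤ deriv K r)
    {r : ℝ} (hr : r ∈ Ioo 0 R) : 0 ≤ pohozaev n p K U b r := by
  refine le_of_deriv_nonneg_of_tendsto hr.1 (fun t ht => h.pohozaev_deriv hp hpn hK
    ⟨ht.1, ht.2.trans_lt hr.2⟩ (hKd t ⟨ht.1, ht.2.trans_lt hr.2⟩).hasDerivAt) ?_
    (h.pohozaev_tendsto hp hpn (hr.1.trans hr.2) hK hM)
  intro t ht
  have ht' : t ∈ Ioo 0 R := ⟨ht.1, ht.2.trans hr.2⟩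
  have := hKm t ht'
  have := h.U_pos t ht'
  have := ht.1
  have := critExp_pos hp hpn
  positivity

theorem pohozaev_mono (h : RadialProfile n p K R d U b) (hp : 1 < p) (hpn : p < n)
    (hK : ∀ r ∈ Ioo 0 R, 0 < K r)
    (hKd : ∀ r ∈ Ioo 0 R, DifferentiableAt ℝ K r) (hKm : ∀ r ∈ Ioo 0 R, 0 ≤ deriv K r) :
    MonotoneOn (pohozaev n p K U b) (Ioo 0 R) := by
  refine monotoneOn_Ioo_of_hasDerivAt
    (fun t ht => h.pohozaev_deriv hp hpn hK ht (hKd t ht).hasDerivAt) ?_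
  intro t ht
  have := hKm t ht
  have := h.U_pos t ht
  have := ht.1
  have := critExp_pos hp hpn
  positivity

/-- Differentiating b U^(-β) reproduces the three terms of P. For constant K, P vanishes and this
quotient is constant, so in general it measures the deviation from a bubble. -/
theorem quotient_deriv (h : RadialProfile n p K R d U b) (hp : 1 < p) (hpn : p < n)
    (hK : ∀ r ∈ Ioo 0 R, 0 < K r) {r : ℝ} (hr : r ∈ Ioo 0 R) :
    HasDerivAt (fun t => b t * U t ^ (-(critExp n p * (1 - 1 / p))))
      (critExp n p * pohozaev n p K U b r * U r ^ (-(critExp n p * (1 - 1 / p)) - 1) /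
        (r ^ n * r)) r := by
  have hq := critExp_pos hp hpn
  set q := critExp n p with hqdef
  have hU := h.U_pos r hr
  have hb := h.b_pos hK hr
  have hr0 : r ≠ 0 := hr.1.ne'
  have ha : r * b r ≠ 0 := by positivity
  have hUd := h.U_deriv r hr
  have hbd := h.b_deriv r hr
  rw [← hqdef] at hbd
  have h3 := hbd.mul (hUd.rpow_const (p := -(q * (1 - 1 / p))) (Or.inl hU.ne'))
  refine h3.congr_deriv ?_
  unfold pohozaev
  rw [← hqdef]
  set σ := 1 / (p - 1) with hσ
  have e2 : (r * b r) ^ (σ + 1) = r * b r * (r * b r) ^ σ := by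
    rw [Real.rpow_add_one ha]; ring
  have e3 : U r ^ q = U r * U r ^ (q - 1) := by
    rw [Real.rpow_sub_one hU.ne']; field_simp
  have e4 : U r ^ (-(q * (1 - 1 / p))) = U r * U r ^ (-(q * (1 - 1 / p)) - 1) := by
    rw [Real.rpow_sub_one hU.ne']; field_simp
  rw [e2, e3, e4]
  generalize (r * b r) ^ σ = s
  generalize U r ^ (q - 1) = v
  generalize U r ^ (-(q * (1 - 1 / p)) - 1) = z
  have : p ≠ 0 := by linarith
  field_simp
  ring

/-- Where `K` is nondecreasing, the quotient `b U^{-β}` is bounded below by its value at the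
centre. -/
theorem quotient_ge (h : RadialProfile n p K R d U b) (hp : 1 < p) (hpn : p < n)
    {A M : ℝ} (hA : 0 < A) (hAK : ∀ r ∈ Ioo 0 R, A ≤ K r) (hM : ∀ r ∈ Ioo 0 R, K r ≤ M)
    (hKd : ∀ r ∈ Ioo 0 R, DifferentiableAt ℝ K r) (hKm : ∀ r ∈ Ioo 0 R, 0 ≤ deriv K r)
    {r : ℝ} (hr : r ∈ Ioo 0 R) :
    A / n * d ^ (p / (n - p)) ≤ b r * U r ^ (-(critExp n p * (1 - 1 / p))) := by
  have hq := critExp_pos hp hpn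
  have hq1 : 1 ≤ critExp n p := (hp.trans (lt_critExp hp hpn)).le
  have hn : n ≠ 0 := by rintro rfl; simp at hpn; linarith
  have hK : ∀ r ∈ Ioo 0 R, 0 < K r := fun r hr => hA.trans_le (hAK r hr)
  have hd := h.d_pos hK (hr.1.trans hr.2)
  have hmono : MonotoneOn (fun t => b t * U t ^ (-(critExp n p * (1 - 1 / p)))) (Ioo 0 R) := by
    refine monotoneOn_Ioo_of_hasDerivAt (fun t ht => h.quotient_deriv hp hpn hK ht) ?_
    intro t ht
    have := h.pohozaev_nonneg hp hpn hK hM hKd hKm ht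
    have := h.U_pos t ht
    have := ht.1
    positivity
  -- By `b_ge` the quotient at t is at least A/n · U(t)^(q-1-β), and q - 1 - β = α; monotonicity
  -- transports the limit as t → 0 out to r.
  have hlim : Tendsto (fun t => A / n * U t ^ (p / (n - p))) (𝓝[>] 0)
      (𝓝 (A / n * d ^ (p / (n - p)))) :=
    (h.U_tendsto.rpow_const (Or.inl hd.ne')).const_mul _
  refine le_of_tendsto hlim ?_
  filter_upwards [Ioo_mem_nhdsGT hr.1] with t ht
  have ht' : t ∈ Ioo 0 R := ⟨ht.1, ht.2.trans hr.2⟩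
  refine le_trans ?_ (hmono ht' hr ht.2.le)
  have hU := h.U_pos t ht'
  have h1 := mul_le_mul_of_nonneg_right (h.b_ge hn hq1 hA hAK ht')
    (Real.rpow_nonneg hU.le (-(critExp n p * (1 - 1 / p))))
  refine le_trans (le_of_eq ?_) h1
  have e : p / (n - p) = (critExp n p - 1) + -(critExp n p * (1 - 1 / p)) := by
    unfold critExp
    have : (n : ℝ) - p ≠ 0 := by linarith
    field_simp; ring
  rw [e, Real.rpow_add hU]
  ring

/-- Where `K` is nondecreasing, `U` lies below the explicit bubble with `K ≡ A`. -/
theorem bubble_bound (h : RadialProfile n p K R d U b) (hp : 1 < p) (hpn : p < n)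
    {A M : ℝ} (hA : 0 < A) (hAK : ∀ r ∈ Ioo 0 R, A ≤ K r) (hM : ∀ r ∈ Ioo 0 R, K r ≤ M)
    (hKd : ∀ r ∈ Ioo 0 R, DifferentiableAt ℝ K r) (hKm : ∀ r ∈ Ioo 0 R, 0 ≤ deriv K r)
    {r : ℝ} (hr : r ∈ Ioo 0 R) :
    d ^ (-(p / (n - p))) + p / (n - p) * (1 - 1 / p) *
      (A / n * d ^ (p / (n - p))) ^ (1 / (p - 1)) * r ^ (1 / (p - 1) + 1)
      ≤ U r ^ (-(p / (n - p))) := by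
  have hK : ∀ r ∈ Ioo 0 R, 0 < K r := fun r hr => hA.trans_le (hAK r hr)
  have hd := h.d_pos hK (hr.1.trans hr.2)
  have hσ0 : 0 < 1 / (p - 1) := by have : 0 < p - 1 := by linarith
                                   positivity
  have hα : 0 < p / (n - p) := by have : 0 < (n : ℝ) - p := by linarith
                                  positivity
  have hβ : critExp n p * (1 - 1 / p) * (1 / (p - 1)) = p / (n - p) + 1 := by
    unfold critExp
    have : (n : ℝ) - p ≠ 0 := by linarith
    have : p - 1 ≠ 0 := by linarith
    field_simp; ring
  have hσp : (1 - 1 / p) * (1 / (p - 1) + 1) = 1 := by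
    have : p - 1 ≠ 0 := by linarith
    have : p ≠ 0 := by linarith
    field_simp; ring
  have hquot := fun t ht => h.quotient_ge hp hpn hA hAK hM hKd hKm (r := t) ht
  have hUdr := h.U_deriv
  set α := p / (n - p) with hαdef
  set σ := 1 / (p - 1) with hσ
  set β := critExp n p * (1 - 1 / p) with hβdef
  set c := A / n * d ^ α with hc
  have hn : (0 : ℝ) < n := by linarith
  have hc0 : 0 < c := by positivity
  -- From b ≥ c U^β and βσ = α + 1 one gets U' ≤ -c^σ t^σ U^(α+1), which is linear in terms of
  -- U^(-α) and integrates explicitly.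
  suffices key : d ^ (-α) ≤ U r ^ (-α) - α * (1 - 1 / p) * c ^ σ * r ^ (σ + 1) by linarith
  refine le_of_deriv_nonneg_of_tendsto hr.1
    (F := fun r => U r ^ (-α) - α * (1 - 1 / p) * c ^ σ * r ^ (σ + 1))
    (F' := fun t => -(t * b t) ^ σ * (-α) * U t ^ (-α - 1) -
      α * (1 - 1 / p) * c ^ σ * ((σ + 1) * t ^ σ)) ?_ ?_ ?_
  · intro t ht
    have ht' : t ∈ Ioo 0 R := ⟨ht.1, ht.2.trans_lt hr.2⟩
    have h1 := (Real.hasDerivAt_rpow_const (x := t) (p := σ + 1) (Or.inl ht.1.ne')).const_mul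
      (α * (1 - 1 / p) * c ^ σ)
    rw [add_sub_cancel_right] at h1
    exact ((hUdr t ht').rpow_const (Or.inl (h.U_pos t ht').ne')).sub h1
  · intro t ht
    have ht' : t ∈ Ioo 0 R := ⟨ht.1, ht.2.trans hr.2⟩
    have hU := h.U_pos t ht'
    have h1 : c * U t ^ β ≤ b t := by
      have := mul_le_mul_of_nonneg_right (hquot t ht') (Real.rpow_nonneg hU.le β)
      rwa [mul_assoc (b t), ← Real.rpow_add hU, neg_add_cancel, Real.rpow_zero, mul_one] at this
    have h2 : c ^ σ * t ^ σ * U t ^ (α + 1) ≤ (t * b t) ^ σ := by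
      have h3 : (t * (c * U t ^ β)) ^ σ ≤ (t * b t) ^ σ := by
        have := ht.1
        gcongr
      rw [Real.mul_rpow ht.1.le (by positivity), Real.mul_rpow hc0.le (by positivity),
        ← Real.rpow_mul hU.le, hβ] at h3
      linarith
    have h4 : U t ^ (α + 1) * U t ^ (-α - 1) = 1 := by
      rw [← Real.rpow_add hU, show α + 1 + (-α - 1) = 0 by ring, Real.rpow_zero]
    have h5 : 0 < U t ^ (-α - 1) := by positivity
    have h6 := mul_le_mul_of_nonneg_right h2 h5.le
    rw [mul_assoc, h4, mul_one] at h6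
    have h7 : α * (1 - 1 / p) * c ^ σ * ((σ + 1) * t ^ σ) = α * (c ^ σ * t ^ σ) := by
      linear_combination (α * c ^ σ * t ^ σ) * hσp
    rw [h7]
    nlinarith
  · have h1 : Tendsto (fun r : ℝ => α * (1 - 1 / p) * c ^ σ * r ^ (σ + 1)) (𝓝[>] 0) (𝓝 0) := by
      have h1 : Tendsto (fun r : ℝ => α * (1 - 1 / p) * c ^ σ * r ^ (σ + 1)) (𝓝 0)
          (𝓝 (α * (1 - 1 / p) * c ^ σ * 0 ^ (σ + 1))) :=
        ((Real.continuousAt_rpow_const 0 (σ + 1) (Or.inr (by linarith))).const_mul _).tendsto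
      rw [Real.zero_rpow (by linarith), mul_zero] at h1
      exact h1.mono_left nhdsWithin_le_nhds
    simpa using (h.U_tendsto.rpow_const (p := -α) (Or.inl hd.ne')).sub h1

end RadialProfile

/-! ### The core and the size of the Pohozaev function -/

/-- With k = σ + 1 and n = j + 2 one has k(j+1) = n + ℓ*, so this is an explicit antiderivative for
t^(n+ℓ*-1) times the q-th power of the bubble. -/
theorem hasDerivAt_ratio_pow {k m c t : ℝ} (j : ℕ) (ht : 0 < t) (hm : 0 < m) (hc : 0 < c) :
    HasDerivAt (fun t : ℝ => (t ^ k / (m + c * t ^ k)) ^ (j + 1))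
      ((j + 1) * k * m * t ^ (k * (j + 1) - 1) / (m + c * t ^ k) ^ (j + 2)) t := by
  have h0 : 0 < t ^ k := Real.rpow_pos_of_pos ht k
  have hD : m + c * t ^ k ≠ 0 := by positivity
  have h1 := Real.hasDerivAt_rpow_const (x := t) (p := k) (Or.inl ht.ne')
  have h2 := (h1.div ((h1.const_mul c).const_add m) hD).pow (j + 1)
  refine h2.congr_deriv ?_
  have e1 : t ^ (k * (j + 1) - 1) = (t ^ k) ^ j * t ^ (k - 1) := by
    rw [← Real.rpow_natCast, ← Real.rpow_mul ht.le, ← Real.rpow_add ht]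
    congr 1; ring
  rw [e1]
  simp only [Nat.add_sub_cancel, Pi.div_apply, div_pow]
  generalize t ^ (k - 1) = y at *
  generalize t ^ k = x at *
  push_cast
  field_simp
  ring

theorem two_le_of_lt {n : ℕ} {p : ℝ} (hp : 1 < p) (hpn : p < n) : 2 ≤ n := by
  have : (1 : ℝ) < n := hp.trans hpn
  exact_mod_cast this

theorem flatThreshold_pos {n : ℕ} {p : ℝ} (hp : 1 < p) (hpn : p < n) :
    0 < flatThreshold n p := by
  unfold flatThreshold
  exact div_pos (by linarith) (by linarith)

namespace RadialProfile

/-- At r = κ d^(-α) the loss in `U_ge` scales as d to the power (q-1)σ - α(σ+1) = 1. Hence κ depends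
only on n, p and M. -/
theorem exists_core {n : ℕ} {p M : ℝ} (hp : 1 < p) (hpn : p < n) (hM : 0 < M) :
    ∃ κ : ℝ, 0 < κ ∧ ∀ {K : ℝ → ℝ} {R d : ℝ} {U b : ℝ → ℝ}, RadialProfile n p K R d U b →
      (∀ r ∈ Ioo 0 R, 0 < K r) → (∀ r ∈ Ioo 0 R, K r ≤ M) →
      ∀ r ∈ Ioo 0 R, r ≤ κ * d ^ (-(p / (n - p))) → d / 2 ≤ U r := by
  have hn : (0 : ℝ) < n := by linarith
  have hn0 : n ≠ 0 := by rintro rfl; simp at hn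
  have hq1 : 1 ≤ critExp n p := (hp.trans (lt_critExp hp hpn)).le
  have hσ0 : 0 < 1 / (p - 1) := by have : 0 < p - 1 := by linarith
                                   positivity
  -- κ solves (M/n)^σ κ^(σ+1) = 1/2, so that the loss is at most d/2.
  refine ⟨(1 / (2 * (M / n) ^ (1 / (p - 1)))) ^ (1 / (1 / (p - 1) + 1)), by positivity, ?_⟩
  intro K R d U b h hK hKM r hr hle
  have hd := h.d_pos hK (hr.1.trans hr.2)
  refine le_trans ?_ (h.U_ge hn0 hq1 hp hK hKM hr)
  have hexp : (critExp n p - 1) * (1 / (p - 1)) - p / (n - p) * (1 / (p - 1) + 1) = 1 := by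
    unfold critExp
    have : (n : ℝ) - p ≠ 0 := by linarith
    have : p - 1 ≠ 0 := by linarith
    field_simp; ring
  set σ := 1 / (p - 1) with hσ
  set α := p / (n - p) with hα
  have h1 : r ^ (σ + 1) ≤ (1 / (2 * (M / n) ^ σ)) * d ^ (-(α * (σ + 1))) := by
    refine (Real.rpow_le_rpow hr.1.le hle (by linarith)).trans (le_of_eq ?_)
    rw [Real.mul_rpow (by positivity) (by positivity), ← Real.rpow_mul (by positivity),
      ← Real.rpow_mul hd.le, one_div_mul_cancel (by positivity), Real.rpow_one]
    congr 2; ring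
  have h2 : (M * d ^ (critExp n p - 1) / n) ^ σ = (M / n) ^ σ * d ^ ((critExp n p - 1) * σ) := by
    rw [mul_div_right_comm, Real.mul_rpow (by positivity) (by positivity), ← Real.rpow_mul hd.le]
  have h3 : (M * d ^ (critExp n p - 1) / n) ^ σ * r ^ (σ + 1) ≤ d / 2 := by
    rw [h2]
    calc (M / n) ^ σ * d ^ ((critExp n p - 1) * σ) * r ^ (σ + 1)
        ≤ (M / n) ^ σ * d ^ ((critExp n p - 1) * σ) *
          ((1 / (2 * (M / n) ^ σ)) * d ^ (-(α * (σ + 1)))) := by gcongr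
      _ = (1 / 2) * (d ^ ((critExp n p - 1) * σ) * d ^ (-(α * (σ + 1)))) := by
          field_simp
      _ = d / 2 := by
          rw [← Real.rpow_add hd, ← sub_eq_add_neg, hexp, Real.rpow_one]; ring
  linarith

variable {n : ℕ} {p : ℝ} {K : ℝ → ℝ} {R d : ℝ} {U b : ℝ → ℝ}

/-- The flux leaving a core of radius `κ d^{-α}` is at least of order `d⁻¹`. -/
theorem w_ge (h : RadialProfile n p K R d U b) (hp : 1 < p) (hpn : p < n)
    {A κ : ℝ} (hA : 0 < A) (hκ : 0 < κ) (hAK : ∀ r ∈ Ioo 0 R, A ≤ K r)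
    (hcore : d / 2 ≤ U (κ * d ^ (-(p / (n - p))))) {r : ℝ} (hr : r ∈ Ioo 0 R)
    (hle : κ * d ^ (-(p / (n - p))) ≤ r) :
    κ ^ n * A / n * (1 / 2) ^ (critExp n p - 1) * d⁻¹ ≤ r ^ n * b r := by
  have hn : (0 : ℝ) < n := by linarith
  have hn0 : n ≠ 0 := by rintro rfl; simp at hn
  have hq1 : 1 ≤ critExp n p := (hp.trans (lt_critExp hp hpn)).le
  have hK : ∀ r ∈ Ioo 0 R, 0 < K r := fun r hr => hA.trans_le (hAK r hr)
  have hd := h.d_pos hK (hr.1.trans hr.2)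
  set r₁ := κ * d ^ (-(p / (n - p))) with hr₁
  have hr₁0 : 0 < r₁ := by positivity
  have hr₁R : r₁ ∈ Ioo 0 R := ⟨hr₁0, hle.trans_lt hr.2⟩
  refine le_trans ?_ (h.w_mono hK hr₁R hr hle)
  have h1 : A * (d / 2) ^ (critExp n p - 1) / n ≤ b r₁ := by
    refine le_trans ?_ (h.b_ge hn0 hq1 hA hAK hr₁R)
    have : 0 ≤ critExp n p - 1 := by linarith
    gcongr
  refine le_trans (le_of_eq ?_) (mul_le_mul_of_nonneg_left h1 (pow_nonneg hr₁0.le n))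
  rw [hr₁, mul_pow, ← Real.rpow_natCast (d ^ _), ← Real.rpow_mul hd.le, div_eq_mul_one_div d 2,
    Real.mul_rpow hd.le (by norm_num)]
  -- The exponent is -αn + q - 1 = -1, because q = nα.
  have e : d⁻¹ = d ^ (-(p / (n - p)) * n) * d ^ (critExp n p - 1) := by
    rw [← Real.rpow_add hd, ← Real.rpow_neg_one]
    congr 1
    rw [critExp_eq]; ring
  rw [e]; ring

/-- Lower bound for the Pohozaev function at the edge of the core. -/
theorem pohozaev_ge (h : RadialProfile n p K R d U b) (hp : 1 < p) (hpn : p < n)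
    {M κ c ℓ : ℝ} (hκ : 0 < κ) (hc : 0 < c) (hℓ : 0 < ℓ)
    (hK : ∀ r ∈ Ioo 0 R, 0 < K r) (hM : ∀ r ∈ Ioo 0 R, K r ≤ M)
    (hKd : ∀ r ∈ Ioo 0 R, DifferentiableAt ℝ K r)
    (hKc : ∀ r ∈ Ioo 0 R, c * r ^ (ℓ - 1) ≤ deriv K r)
    (hcore : ∀ r ∈ Ioo 0 R, r ≤ κ * d ^ (-(p / (n - p))) → d / 2 ≤ U r)
    (hR : κ * d ^ (-(p / (n - p))) < R) (hR0 : 0 < R) :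
    c * (1 / 2) ^ critExp n p * κ ^ (n + ℓ) / (critExp n p * (n + ℓ)) *
      d ^ (-(p / (n - p) * ℓ)) ≤ pohozaev n p K U b (κ * d ^ (-(p / (n - p)))) := by
  have hn : (0 : ℝ) < n := by linarith
  have hq := critExp_pos hp hpn
  have hd := h.d_pos hK hR0
  set r₁ := κ * d ^ (-(p / (n - p))) with hr₁
  have hr₁0 : 0 < r₁ := by positivity
  -- C r^(n+ℓ) is the integral over (0, r) of the lower bound t^n · c t^(ℓ-1) · (d/2)^q / q for P'
  -- in the core.
  set C := c * (d / 2) ^ critExp n p / critExp n p / (n + ℓ) with hC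
  have key : 0 ≤ pohozaev n p K U b r₁ - C * r₁ ^ ((n : ℝ) + ℓ) := by
    refine le_of_deriv_nonneg_of_tendsto hr₁0
      (F := fun r => pohozaev n p K U b r - C * r ^ ((n : ℝ) + ℓ))
      (F' := fun t => t ^ n * deriv K t * U t ^ critExp n p / critExp n p -
        C * ((n + ℓ) * t ^ ((n : ℝ) + ℓ - 1))) ?_ ?_ ?_
    · intro t ht
      have ht' : t ∈ Ioo 0 R := ⟨ht.1, ht.2.trans_lt hR⟩
      exact (h.pohozaev_deriv hp hpn hK ht' (hKd t ht').hasDerivAt).sub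
        ((Real.hasDerivAt_rpow_const (Or.inl ht.1.ne')).const_mul C)
    · intro t ht
      have ht0 := ht.1
      have ht' : t ∈ Ioo 0 R := ⟨ht.1, ht.2.trans hR⟩
      have e1 : t ^ ((n : ℝ) + ℓ - 1) = t ^ n * t ^ (ℓ - 1) := by
        rw [← Real.rpow_natCast, ← Real.rpow_add ht0]; congr 1; ring
      have e2 : C * ((n + ℓ) * t ^ ((n : ℝ) + ℓ - 1)) =
          t ^ n * (c * t ^ (ℓ - 1)) * (d / 2) ^ critExp n p / critExp n p := by
        rw [e1, hC]; field_simp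
      rw [e2, sub_nonneg]
      have h1 := hKc t ht'
      have h2 := hcore t ht' ht.2.le
      have h3 : 0 ≤ deriv K t := le_trans (by positivity) h1
      gcongr
    · have h1 : Tendsto (fun r : ℝ => C * r ^ ((n : ℝ) + ℓ)) (𝓝[>] 0) (𝓝 0) := by
        have h1 : Tendsto (fun r : ℝ => C * r ^ ((n : ℝ) + ℓ)) (𝓝 0)
            (𝓝 (C * 0 ^ ((n : ℝ) + ℓ))) :=
          ((Real.continuousAt_rpow_const 0 _ (Or.inr (by linarith))).const_mul _).tendsto
        rw [Real.zero_rpow (by linarith), mul_zero] at h1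
        exact h1.mono_left nhdsWithin_le_nhds
      simpa using (h.pohozaev_tendsto hp hpn hR0 hK hM).sub h1
  refine le_trans (le_of_eq ?_) (sub_nonneg.1 key)
  rw [hC, hr₁, Real.mul_rpow hκ.le (by positivity), ← Real.rpow_mul hd.le, div_eq_mul_one_div d 2,
    Real.mul_rpow hd.le (by norm_num)]
  have e : d ^ (-(p / (n - p) * ℓ)) =
      d ^ critExp n p * d ^ (-(p / (n - p)) * (n + ℓ)) := by
    rw [← Real.rpow_add hd]
    congr 1
    rw [critExp_eq]; ring
  rw [e]
  field_simp

/-- Upper bound for the Pohozaev function when `K'` is at most of order `r^{ℓ* - 1}`. -/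
theorem pohozaev_le (h : RadialProfile n p K R d U b) (hp : 1 < p) (hpn : p < n)
    {A M C : ℝ} (hA : 0 < A) (hC : 0 ≤ C)
    (hAK : ∀ r ∈ Ioo 0 R, A ≤ K r) (hM : ∀ r ∈ Ioo 0 R, K r ≤ M)
    (hKd : ∀ r ∈ Ioo 0 R, DifferentiableAt ℝ K r) (hKm : ∀ r ∈ Ioo 0 R, 0 ≤ deriv K r)
    (hKC : ∀ r ∈ Ioo 0 R, deriv K r ≤ C * r ^ (flatThreshold n p - 1))
    {r : ℝ} (hr : r ∈ Ioo 0 R) :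
    pohozaev n p K U b r ≤ C / (critExp n p * (n - 1) * (1 / (p - 1) + 1)) *
      ((p / (n - p) * (1 - 1 / p) * (A / n) ^ (1 / (p - 1)))⁻¹) ^ (n - 1) *
      d ^ (-(1 / (p - 1) + 1)) := by
  have hK : ∀ r ∈ Ioo 0 R, 0 < K r := fun r hr => hA.trans_le (hAK r hr)
  have hR0 := hr.1.trans hr.2
  have hd := h.d_pos hK hR0
  have hq := critExp_pos hp hpn
  have hbub := fun t ht => h.bubble_bound hp hpn hA hAK hM hKd hKm (r := t) ht
  obtain ⟨j, rfl⟩ : ∃ j, n = j + 2 := ⟨n - 2, by have := two_le_of_lt hp hpn; omega⟩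
  have hpos1 : 0 < p - 1 := by linarith
  have hpos2 : 0 < ((j + 2 : ℕ) : ℝ) - p := by linarith
  have hσ0 : 0 < 1 / (p - 1) := by positivity
  have hα0 : 0 < p / (((j + 2 : ℕ) : ℝ) - p) := by positivity
  have hp' : 0 < 1 - 1 / p := by
    have : 1 / p < 1 := by rw [div_lt_one (by linarith)]; exact hp
    linarith
  have hexp1 : (1 / (p - 1) + 1) * (j + 1) = ((j + 2 : ℕ) : ℝ) + flatThreshold (j + 2) p := by
    unfold flatThreshold; push_cast; field_simp; ring
  have hexp2 : p / (((j + 2 : ℕ) : ℝ) - p) + -(p / (((j + 2 : ℕ) : ℝ) - p) * (1 / (p - 1)) *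
      ((j + 1 : ℕ) : ℝ)) = -(1 / (p - 1) + 1) := by
    push_cast at hpos2 ⊢; field_simp; ring
  have hqα := critExp_eq (n := j + 2) (p := p)
  set q := critExp (j + 2) p with hqdef
  set α := p / (((j + 2 : ℕ) : ℝ) - p) with hα
  set σ := 1 / (p - 1) with hσ
  set k := σ + 1 with hk
  have hk0 : 0 < k := by linarith
  set c₀ := α * (1 - 1 / p) * (A / ((j + 2 : ℕ) : ℝ)) ^ σ with hc₀
  have hc₀0 : 0 < c₀ := by positivity
  set m := d ^ (-α) with hm
  have hm0 : 0 < m := by positivity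
  set c := c₀ * d ^ (α * σ) with hc
  have hc0 : 0 < c := by positivity
  have hbub' : ∀ t ∈ Ioo 0 R, m + c * t ^ k ≤ U t ^ (-α) := by
    intro t ht
    refine le_trans (le_of_eq ?_) (hbub t ht)
    rw [Real.mul_rpow (by positivity) (by positivity), ← Real.rpow_mul hd.le]
    ring
  have hUq : ∀ t ∈ Ioo 0 R, U t ^ q ≤ 1 / (m + c * t ^ k) ^ (j + 2) := by
    intro t ht
    have hU := h.U_pos t ht
    have ht0 := ht.1
    have e : U t ^ q = 1 / (U t ^ (-α)) ^ (j + 2) := by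
      rw [← Real.rpow_natCast, ← Real.rpow_mul hU.le, one_div, ← Real.rpow_neg hU.le, hqα]
      congr 1; ring
    rw [e]
    have := hbub' t ht
    gcongr
  -- C₂ normalises the antiderivative so that its derivative is the upper bound for P' given by the
  -- bubble.
  set C₂ := C / q / ((j + 1) * k * m) with hC₂
  have key : 0 ≤ C₂ * (r ^ k / (m + c * r ^ k)) ^ (j + 1) - pohozaev (j + 2) p K U b r := by
    refine le_of_deriv_nonneg_of_tendsto hr.1
      (F := fun r => C₂ * (r ^ k / (m + c * r ^ k)) ^ (j + 1) - pohozaev (j + 2) p K U b r)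
      (F' := fun t => C₂ * ((j + 1) * k * m * t ^ (k * (j + 1) - 1) / (m + c * t ^ k) ^ (j + 2)) -
        t ^ (j + 2) * deriv K t * U t ^ q / q) ?_ ?_ ?_
    · intro t ht
      have ht' : t ∈ Ioo 0 R := ⟨ht.1, ht.2.trans_lt hr.2⟩
      exact ((hasDerivAt_ratio_pow j ht.1 hm0 hc0).const_mul C₂).sub
        (h.pohozaev_deriv hp hpn hK ht' (hKd t ht').hasDerivAt)
    · intro t ht
      have ht0 := ht.1
      have ht' : t ∈ Ioo 0 R := ⟨ht.1, ht.2.trans hr.2⟩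
      have e1 : t ^ (k * (j + 1) - 1) = t ^ (j + 2) * t ^ (flatThreshold (j + 2) p - 1) := by
        rw [hexp1, ← Real.rpow_natCast, ← Real.rpow_add ht0]; congr 1; ring
      have h1 := hKC t ht'
      have h2 := hUq t ht'
      have h3 := hKm t ht'
      have hU := h.U_pos t ht'
      have e2 : C₂ * ((j + 1) * k * m * t ^ (k * (j + 1) - 1) / (m + c * t ^ k) ^ (j + 2)) =
          t ^ (j + 2) * (C * t ^ (flatThreshold (j + 2) p - 1)) *
            (1 / (m + c * t ^ k) ^ (j + 2)) / q := by
        rw [e1, hC₂]; field_simp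
      rw [e2, sub_nonneg]
      gcongr
    · have h1 : Tendsto (fun r : ℝ => C₂ * (r ^ k / (m + c * r ^ k)) ^ (j + 1)) (𝓝[>] 0) (𝓝 0) := by
        have hck : ContinuousAt (fun r : ℝ => r ^ k) 0 :=
          Real.continuousAt_rpow_const 0 _ (Or.inr hk0.le)
        have h0 : (0 : ℝ) ^ k = 0 := Real.zero_rpow hk0.ne'
        have h1 : ContinuousAt (fun r : ℝ => C₂ * (r ^ k / (m + c * r ^ k)) ^ (j + 1)) 0 := by
          refine ((hck.div ((hck.const_mul c).const_add m) ?_).pow (j + 1)).const_mul C₂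
          simp only [h0, mul_zero, add_zero]
          exact hm0.ne'
        have h2 := h1.tendsto
        simp only [h0, zero_div, mul_zero, add_zero, ne_eq, Nat.add_eq_zero_iff, one_ne_zero,
          and_false, not_false_eq_true, zero_pow] at h2
        exact h2.mono_left nhdsWithin_le_nhds
      simpa using h1.sub (h.pohozaev_tendsto hp hpn hR0 hK hM)
  -- Dropping m bounds the ratio uniformly in r, so the final bound depends on d alone.
  have hy : r ^ k / (m + c * r ^ k) ≤ c⁻¹ := by
    have : 0 < r ^ k := Real.rpow_pos_of_pos hr.1 _
    rw [div_le_iff₀ (by positivity), mul_add, inv_mul_cancel_left₀ hc0.ne']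
    have : 0 < c⁻¹ * m := by positivity
    linarith
  have hy0 : 0 ≤ r ^ k / (m + c * r ^ k) := by
    have : 0 < r ^ k := Real.rpow_pos_of_pos hr.1 _
    positivity
  have hC₂0 : 0 ≤ C₂ := by positivity
  calc pohozaev (j + 2) p K U b r ≤ C₂ * (r ^ k / (m + c * r ^ k)) ^ (j + 1) := sub_nonneg.1 key
    _ ≤ C₂ * c⁻¹ ^ (j + 1) := by gcongr
    _ = _ := by
      have e1 : m⁻¹ = d ^ α := by rw [hm, Real.rpow_neg hd.le, inv_inv]
      have e2 : (d ^ (α * σ))⁻¹ ^ (j + 1) = d ^ (-(α * σ * ((j + 1 : ℕ) : ℝ))) := by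
        rw [← Real.rpow_neg hd.le, ← Real.rpow_natCast, ← Real.rpow_mul hd.le]; congr 1; ring
      rw [← hexp2, Real.rpow_add hd, hC₂, hc, mul_inv, mul_pow, e2, ← e1]
      have e3 : ((j + 2 : ℕ) : ℝ) - 1 = j + 1 := by push_cast; ring
      rw [e3, show j + 2 - 1 = j + 1 by omega]
      field_simp

/-! ### Comparing powers of the central value -/

/-- If `K' = O(r^{ℓ* - 1})`, then a profile cannot reach zero at a small radius. -/
theorem exists_radius_le_of_tendsto_zero {n : ℕ} {p A M C : ℝ} (hp : 1 < p) (hpn : p < n)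
    (hA : 0 < A) (hM : 0 < M) (hC : 0 < C) :
    ∃ R₀ : ℝ, 0 < R₀ ∧ ∀ {K : ℝ → ℝ} {R d : ℝ} {U b : ℝ → ℝ}, RadialProfile n p K R d U b →
      0 < R → (∀ r ∈ Ioo 0 R, A ≤ K r) → (∀ r ∈ Ioo 0 R, K r ≤ M) →
      (∀ r ∈ Ioo 0 R, DifferentiableAt ℝ K r) → (∀ r ∈ Ioo 0 R, 0 ≤ deriv K r) →
      (∀ r ∈ Ioo 0 R, deriv K r ≤ C * r ^ (flatThreshold n p - 1)) →
      Tendsto U (𝓝[<] R) (𝓝 0) → R₀ ≤ R := by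
  obtain ⟨κ, hκ, hcore⟩ := exists_core hp hpn hM
  have hn : (0 : ℝ) < n := by linarith
  have hn0 : n ≠ 0 := by rintro rfl; simp at hn
  have hq := critExp_pos hp hpn
  have hq1 : 1 ≤ critExp n p := (hp.trans (lt_critExp hp hpn)).le
  have hℓ := flatThreshold_pos hp hpn
  have hpos1 : 0 < p - 1 := by linarith
  have hpos2 : 0 < (n : ℝ) - p := by linarith
  have hn1 : 0 < (n : ℝ) - 1 := by linarith
  have hσ0 : 0 < 1 / (p - 1) := by positivity
  have hp' : 0 < 1 - 1 / p := by
    have : 1 / p < 1 := by rw [div_lt_one (by linarith)]; exact hp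
    linarith
  set C₂ := C / (critExp n p * (n - 1) * (1 / (p - 1) + 1)) *
      ((p / (n - p) * (1 - 1 / p) * (A / n) ^ (1 / (p - 1)))⁻¹) ^ (n - 1) with hC₂
  have hC₂0 : 0 < C₂ := by positivity
  set c₁ := κ ^ n * A / n * (1 / 2) ^ (critExp n p - 1) with hc₁
  have hc₁0 : 0 < c₁ := by positivity
  set σ := 1 / (p - 1) with hσ
  -- L is the quotient of the coefficients of d^(-(σ+1)) in the lower and upper bounds for P at the
  -- zero; the target is L ≤ R^ℓ*.
  set L := (1 - 1 / p) * c₁ ^ (σ + 1) / C₂ with hL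
  have hL0 : 0 < L := by positivity
  refine ⟨L ^ (1 / flatThreshold n p), by positivity, ?_⟩
  intro K R d U b h hR hAK hKM hKd hKm hKC hU0
  have hK : ∀ r ∈ Ioo 0 R, 0 < K r := fun r hr => hA.trans_le (hAK r hr)
  have hd := h.d_pos hK hR
  have hmem : ∀ᶠ r in 𝓝[<] R, r ∈ Ioo 0 R := Ioo_mem_nhdsLT hR
  set r₁ := κ * d ^ (-(p / (n - p))) with hr₁
  have hr₁0 : 0 < r₁ := by positivity
  have hr₁R : r₁ < R := by
    by_contra hcon
    rw [not_lt] at hcon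
    have : d / 2 ≤ 0 := by
      refine ge_of_tendsto hU0 ?_
      filter_upwards [hmem] with r hr
      exact hcore h hK hKM r hr (hr.2.le.trans hcon)
    linarith
  have hcore₁ := hcore h hK hKM r₁ ⟨hr₁0, hr₁R⟩ le_rfl
  -- The profile is controlled only on (0, R), so the term U b is kept for r < R; it disappears as r
  -- → R because b is bounded. The exponent of R arises from n + (1-n)(σ+1) = -ℓ*.
  have hbound : ∀ᶠ r in 𝓝[<] R, (1 - 1 / p) * (c₁ ^ (σ + 1) * d ^ (-(σ + 1)) *
      R ^ (-flatThreshold n p)) ≤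
      C₂ * d ^ (-(σ + 1)) + U r * (n / critExp n p * (R ^ n * (M * d ^ (critExp n p - 1) / n))) := by
    filter_upwards [Ioo_mem_nhdsLT hr₁R] with r hr
    have hr' : r ∈ Ioo 0 R := ⟨hr₁0.trans hr.1, hr.2⟩
    have hr0 := hr'.1
    have h1 := h.w_ge hp hpn hA hκ hAK hcore₁ hr' hr.1.le
    have h2 := h.pohozaev_le hp hpn hA hC.le hAK hKM hKd hKm hKC hr'
    have h3 := h.b_le hn0 hq1 hK hKM hr'
    have hb := h.b_pos hK hr'
    have hU := h.U_pos r hr'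
    have hKr := hK r hr'
    have h4 : c₁ * d⁻¹ * r ^ (1 - n : ℝ) ≤ r * b r := by
      have := mul_le_mul_of_nonneg_right h1 (Real.rpow_nonneg hr0.le (1 - n : ℝ))
      refine this.trans (le_of_eq ?_)
      rw [Real.rpow_sub hr0, Real.rpow_one, Real.rpow_natCast]
      field_simp
    have h5 : c₁ ^ (σ + 1) * d ^ (-(σ + 1)) * R ^ (-flatThreshold n p) ≤
        r ^ n * (r * b r) ^ (σ + 1) := by
      have h6 : (c₁ * d⁻¹ * r ^ (1 - n : ℝ)) ^ (σ + 1) ≤ (r * b r) ^ (σ + 1) := by gcongr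
      have h7 : R ^ (-flatThreshold n p) ≤ r ^ (-flatThreshold n p) :=
        Real.rpow_le_rpow_of_nonpos hr0 hr.2.le (by linarith)
      have h8 : r ^ (-flatThreshold n p) = r ^ n * r ^ ((1 - n : ℝ) * (σ + 1)) := by
        rw [← Real.rpow_natCast, ← Real.rpow_add hr0]
        congr 1
        rw [hσ]; unfold flatThreshold; field_simp; ring
      rw [Real.mul_rpow (by positivity) (by positivity), Real.mul_rpow (by positivity)
        (by positivity), Real.inv_rpow hd.le, ← Real.rpow_neg hd.le,
        ← Real.rpow_mul hr0.le] at h6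
      calc c₁ ^ (σ + 1) * d ^ (-(σ + 1)) * R ^ (-flatThreshold n p)
          ≤ c₁ ^ (σ + 1) * d ^ (-(σ + 1)) * r ^ (-flatThreshold n p) := by gcongr
        _ = r ^ n * (c₁ ^ (σ + 1) * d ^ (-(σ + 1)) * r ^ ((1 - n : ℝ) * (σ + 1))) := by
            rw [h8]; ring
        _ ≤ r ^ n * (r * b r) ^ (σ + 1) := by gcongr
    have h9 : r ^ n * b r ≤ R ^ n * (M * d ^ (critExp n p - 1) / n) := by
      have := hr.2.le
      gcongr
    have h10 : (1 - 1 / p) * (r ^ n * (r * b r) ^ (σ + 1)) ≤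
        pohozaev n p K U b r + U r * (n / critExp n p * (r ^ n * b r)) := by
      unfold pohozaev
      rw [← hσ]
      have : 0 ≤ r ^ n * (K r * U r ^ critExp n p / critExp n p) := by positivity
      linarith
    calc _ ≤ (1 - 1 / p) * (r ^ n * (r * b r) ^ (σ + 1)) := by gcongr
      _ ≤ _ := h10
      _ ≤ _ := by gcongr
  have hlim : Tendsto (fun r => C₂ * d ^ (-(σ + 1)) +
      U r * (n / critExp n p * (R ^ n * (M * d ^ (critExp n p - 1) / n)))) (𝓝[<] R)
      (𝓝 (C₂ * d ^ (-(σ + 1)))) := by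
    simpa using (hU0.mul_const _).const_add (C₂ * d ^ (-(σ + 1)))
  have hfin := ge_of_tendsto hlim hbound
  have hdk : 0 < d ^ (-(σ + 1)) := by positivity
  have hRℓ : 0 < R ^ flatThreshold n p := by positivity
  have hLR : L ≤ R ^ flatThreshold n p := by
    rw [Real.rpow_neg hR.le] at hfin
    rw [hL, div_le_iff₀ hC₂0]
    have h1 : d ^ (-(σ + 1)) * ((1 - 1 / p) * c₁ ^ (σ + 1) * (R ^ flatThreshold n p)⁻¹) ≤
        d ^ (-(σ + 1)) * C₂ := by linarith
    have h2 := le_of_mul_le_mul_left h1 hdk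
    rw [← div_eq_mul_inv, div_le_iff₀ hRℓ] at h2
    linarith
  calc L ^ (1 / flatThreshold n p) ≤ (R ^ flatThreshold n p) ^ (1 / flatThreshold n p) := by
        gcongr
    _ = R := by
        rw [← Real.rpow_mul hR.le, mul_one_div_cancel hℓ.ne', Real.rpow_one]

/-- If `K'` is at least of order `r^{ℓ - 1}` with `ℓ < ℓ*`, then profiles with a large value at the
centre do not stay positive on a given interval. -/
theorem eventually_not_radialProfile {n : ℕ} {p A M c ℓ ρ : ℝ} (hp : 1 < p) (hpn : p < n)
    (hA : 0 < A) (hc : 0 < c) (hℓ : 0 < ℓ) (hℓ' : ℓ < flatThreshold n p) (hρ : 0 < ρ)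
    {K : ℝ → ℝ} (hAK : ∀ r ∈ Ioo 0 ρ, A ≤ K r) (hKM : ∀ r ∈ Ioo 0 ρ, K r ≤ M)
    (hKd : ∀ r ∈ Ioo 0 ρ, DifferentiableAt ℝ K r)
    (hKc : ∀ r ∈ Ioo 0 ρ, c * r ^ (ℓ - 1) ≤ deriv K r) :
    ∀ᶠ d in atTop, ∀ U b : ℝ → ℝ, ¬ RadialProfile n p K ρ d U b := by
  have hρ2 : ρ / 2 ∈ Ioo 0 ρ := ⟨by linarith, by linarith⟩
  have hM : 0 < M := hA.trans_le ((hAK _ hρ2).trans (hKM _ hρ2))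
  obtain ⟨κ, hκ, hcore⟩ := exists_core hp hpn hM
  have hK : ∀ r ∈ Ioo 0 ρ, 0 < K r := fun r hr => hA.trans_le (hAK r hr)
  have hKm : ∀ r ∈ Ioo 0 ρ, 0 ≤ deriv K r := fun r hr =>
    le_trans (by have := hr.1; positivity) (hKc r hr)
  have hn : (0 : ℝ) < n := by linarith
  have hq := critExp_pos hp hpn
  have hpos1 : 0 < p - 1 := by linarith
  have hpos2 : 0 < (n : ℝ) - p := by linarith
  have hσ0 : 0 < 1 / (p - 1) := by positivity
  have hα0 : 0 < p / (n - p) := by positivity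
  have hp' : 0 < 1 - 1 / p := by
    have : 1 / p < 1 := by rw [div_lt_one (by linarith)]; exact hp
    linarith
  set σ := 1 / (p - 1) with hσ
  set α := p / (n - p) with hα
  set q := critExp n p with hqdef
  have hpq : p ≤ q := (lt_critExp hp hpn).le
  have hασ : α * σ * (1 / α) = σ := by field_simp
  have hσp : (σ + 1) = σ * p := by rw [hσ]; field_simp; ring
  have hexp : 0 < (σ + 1) - α * ℓ := by
    have : α * flatThreshold n p = σ + 1 := by
      rw [hα, hσ]; unfold flatThreshold; field_simp; ring
    rw [← this, ← mul_sub]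
    exact mul_pos hα0 (by linarith)
  set c₁ := c * (1 / 2) ^ q * κ ^ (n + ℓ) / (q * (n + ℓ)) with hc₁
  have hc₁0 : 0 < c₁ := by positivity
  set c₂ := α * (1 - 1 / p) * (A / n) ^ σ * (ρ / 2) ^ (σ + 1) with hc₂
  have hc₂0 : 0 < c₂ := by positivity
  -- c₂ d^(ασ) is the bubble bound for U^(-α) at ρ/2; raising it to the power -1/α gives U(ρ/2) ≤ X
  -- d^(-σ).
  set X := c₂ ^ (-(1 / α)) with hX
  have hX0 : 0 < X := by positivity
  set C := ρ ^ n * ((4 / ρ * X) ^ p + M * X ^ q / q) with hC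
  have hlarge : ∀ᶠ d : ℝ in atTop, C / c₁ < d ^ ((σ + 1) - α * ℓ) :=
    (tendsto_rpow_atTop hexp).eventually_gt_atTop _
  have hsmall : ∀ᶠ d : ℝ in atTop, κ * d ^ (-α) < ρ / 2 := by
    have : Tendsto (fun d : ℝ => κ * d ^ (-α)) atTop (𝓝 (κ * 0)) :=
      (tendsto_rpow_neg_atTop hα0).const_mul κ
    rw [mul_zero] at this
    exact this.eventually_lt_const (by linarith)
  filter_upwards [hlarge, hsmall, eventually_ge_atTop 1] with d hd1 hd2 hd3 U b h
  have hd : 0 < d := by linarith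
  have hr₁0 : 0 < κ * d ^ (-α) := by positivity
  have hlow := h.pohozaev_ge hp hpn hκ hc hℓ hK hKM hKd hKc (hcore h hK hKM)
    (hd2.trans hρ2.2) hρ
  have hUX : U (ρ / 2) ≤ X * d ^ (-σ) := by
    have h1 := h.bubble_bound hp hpn hA hAK hKM hKd hKm hρ2
    rw [← hα, ← hσ, Real.mul_rpow (by positivity) (by positivity), ← Real.rpow_mul hd.le] at h1
    have hU := h.U_pos _ hρ2
    have h2 : c₂ * d ^ (α * σ) ≤ U (ρ / 2) ^ (-α) := by
      refine le_trans ?_ h1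
      have : 0 < d ^ (-α) := by positivity
      rw [hc₂]
      linarith
    have h3 := Real.rpow_le_rpow_of_nonpos (z := -(1 / α)) (by positivity) h2
      (by have : 0 < 1 / α := by positivity
          linarith)
    rw [← Real.rpow_mul hU.le, neg_mul_neg, mul_one_div_cancel hα0.ne', Real.rpow_one,
      Real.mul_rpow hc₂0.le (by positivity), ← Real.rpow_mul hd.le, mul_neg, hασ] at h3
    exact h3
  have hmem : ∀ t ∈ Icc (ρ / 2) (3 * ρ / 4), t ∈ Ioo 0 ρ := fun t ht =>
    ⟨by linarith [ht.1], by linarith [ht.2]⟩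
  -- P also contains U': the mean value theorem supplies a radius where U' is as small as U, namely
  -- of order d^(-σ).
  obtain ⟨r, hr, hrd⟩ := exists_hasDerivAt_eq_slope U (fun r => -(r * b r) ^ σ)
    (show ρ / 2 < 3 * ρ / 4 by linarith)
    (fun t ht => (h.U_deriv t (hmem t ht)).continuousAt.continuousWithinAt)
    (fun t ht => h.U_deriv t (hmem t (Ioo_subset_Icc_self ht)))
  have hr' : r ∈ Ioo 0 ρ := hmem r (Ioo_subset_Icc_self hr)
  have hUr : U r ≤ X * d ^ (-σ) := (h.U_antitone hK hρ2 hr' hr.1.le).trans hUX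
  have hU0 := h.U_pos r hr'
  have hb0 := h.b_pos hK hr'
  have hr0 := hr'.1
  have hs : (r * b r) ^ σ ≤ 4 / ρ * X * d ^ (-σ) := by
    have h1 := h.U_pos (3 * ρ / 4) (hmem _ ⟨by linarith, le_rfl⟩)
    have h2 : (r * b r) ^ σ = 4 / ρ * (U (ρ / 2) - U (3 * ρ / 4)) := by
      have : (r * b r) ^ σ = -((U (3 * ρ / 4) - U (ρ / 2)) / (3 * ρ / 4 - ρ / 2)) := by
        rw [← hrd, neg_neg]
      rw [this, show 3 * ρ / 4 - ρ / 2 = ρ / 4 by ring]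
      field_simp
      ring
    rw [h2, mul_assoc]
    gcongr
    linarith
  have hup : pohozaev n p K U b r ≤ C * d ^ (-(σ + 1)) := by
    have h1 : (r * b r) ^ (σ + 1) ≤ (4 / ρ * X) ^ p * d ^ (-(σ + 1)) := by
      rw [hσp, Real.rpow_mul (by positivity), ← neg_mul, Real.rpow_mul hd.le,
        ← Real.mul_rpow (by positivity) (by positivity)]
      gcongr
    have h2 : U r ^ q ≤ X ^ q * d ^ (-(σ + 1)) := by
      calc U r ^ q ≤ (X * d ^ (-σ)) ^ q := by gcongr
        _ = X ^ q * d ^ (-(σ * q)) := by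
          rw [Real.mul_rpow (by positivity) (by positivity), ← Real.rpow_mul hd.le, neg_mul]
        -- Uses d ≥ 1 and σq ≥ σp = σ + 1.
        _ ≤ X ^ q * d ^ (-(σ + 1)) := by
          rw [hσp]
          gcongr
    have h3 : 0 ≤ n / q * (U r * b r) := by positivity
    have h4 : (1 - 1 / p) * (r * b r) ^ (σ + 1) ≤ (r * b r) ^ (σ + 1) := by
      have h5 : 0 ≤ (r * b r) ^ (σ + 1) := by positivity
      have h6 : 0 < 1 / p := by positivity
      nlinarith
    have hKr0 := hK r hr'
    have h5 : K r * U r ^ q / q ≤ M * (X ^ q * d ^ (-(σ + 1))) / q := by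
      have := hKM r hr'
      gcongr
    calc pohozaev n p K U b r ≤ r ^ n * ((4 / ρ * X) ^ p * d ^ (-(σ + 1)) +
          M * (X ^ q * d ^ (-(σ + 1))) / q) := by
          unfold pohozaev
          rw [← hqdef, ← hσ]
          gcongr
          linarith
      _ ≤ ρ ^ n * ((4 / ρ * X) ^ p * d ^ (-(σ + 1)) + M * (X ^ q * d ^ (-(σ + 1))) / q) := by
          have := hr'.2.le
          gcongr
      _ = C * d ^ (-(σ + 1)) := by rw [hC]; ring
  have hmono := h.pohozaev_mono hp hpn hK hKd hKm ⟨hr₁0, hd2.trans hρ2.2⟩ hr'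
    (hd2.le.trans hr.1.le)
  have hcomb : c₁ * d ^ (-(α * ℓ)) ≤ C * d ^ (-(σ + 1)) := (hlow.trans hmono).trans hup
  have hdk : 0 < d ^ (σ + 1) := by positivity
  have h1 := mul_le_mul_of_nonneg_right hcomb hdk.le
  rw [mul_assoc, mul_assoc, ← Real.rpow_add hd, ← Real.rpow_add hd, neg_add_cancel,
    Real.rpow_zero, mul_one, neg_add_eq_sub] at h1
  rw [div_lt_iff₀ hc₁0] at hd1
  linarith

end RadialProfile

/-! ### The radial initial value problem by contraction -/

/-- The weighted mean `∫₀¹ τ^m g(rτ) dτ`, i.e. `r^{-(m+1)} ∫₀^r t^m g(t) dt` for `r ≠ 0`. -/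
def ballAvg (m : ℕ) (g : ℝ → ℝ) (r : ℝ) : ℝ := ∫ τ in (0 : ℝ)..1, τ ^ m * g (r * τ)

/-- The rescaled integral makes continuity at r = 0 automatic. Taken with m = n - 1 and the source K
U^(q-1), this mean is the function b. -/
theorem continuous_ballAvg {m : ℕ} {g : ℝ → ℝ} (hg : Continuous g) :
    Continuous (ballAvg m g) := by
  unfold ballAvg
  apply intervalIntegral.continuous_parametric_intervalIntegral_of_continuous'
  fun_prop

theorem pow_succ_mul_ballAvg (m : ℕ) (g : ℝ → ℝ) (r : ℝ) :
    r ^ (m + 1) * ballAvg m g r = ∫ t in (0 : ℝ)..r, t ^ m * g t := by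
  have h := intervalIntegral.mul_integral_comp_mul_left (a := 0) (b := 1)
    (f := fun t => t ^ m * g t) r
  rw [mul_zero, mul_one] at h
  rw [← h, ballAvg, pow_succ', mul_assoc, ← intervalIntegral.integral_const_mul]
  simp only [mul_pow, mul_assoc]

theorem ballAvg_zero (m : ℕ) (g : ℝ → ℝ) : ballAvg m g 0 = g 0 / (m + 1) := by
  simp [ballAvg, integral_pow, div_eq_inv_mul]

theorem hasDerivAt_ballAvg {m : ℕ} {g : ℝ → ℝ} (hg : Continuous g) {r : ℝ} (hr : r ≠ 0) :
    HasDerivAt (ballAvg m g) ((g r - (m + 1) * ballAvg m g r) / r) r := by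
  have h1 : HasDerivAt (fun r => ∫ t in (0 : ℝ)..r, t ^ m * g t) (r ^ m * g r) r :=
    (Continuous.integral_hasStrictDerivAt (by fun_prop) 0 r).hasDerivAt
  have h2 : HasDerivAt (fun r : ℝ => r ^ (m + 1)) ((m + 1) * r ^ m) r := by
    simpa using hasDerivAt_pow (m + 1) r
  have h3 := h1.div h2 (pow_ne_zero _ hr)
  have h4 : ballAvg m g =ᶠ[𝓝 r]
      (fun r => ∫ t in (0 : ℝ)..r, t ^ m * g t) / (fun r : ℝ => r ^ (m + 1)) := by
    filter_upwards [isOpen_ne.mem_nhds hr] with t ht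
    rw [Pi.div_apply, ← pow_succ_mul_ballAvg, mul_div_cancel_left₀ _ (pow_ne_zero _ ht)]
  refine (h3.congr_of_eventuallyEq h4).congr_deriv ?_
  rw [← pow_succ_mul_ballAvg]
  have : r ^ m ≠ 0 := pow_ne_zero _ hr
  field_simp
  ring

theorem ballAvg_mono {m : ℕ} {g₁ g₂ : ℝ → ℝ} (h₁ : Continuous g₁) (h₂ : Continuous g₂) {r : ℝ}
    (hr : 0 ≤ r) (h : ∀ t ∈ Icc 0 r, g₁ t ≤ g₂ t) : ballAvg m g₁ r ≤ ballAvg m g₂ r := by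
  refine intervalIntegral.integral_mono_on zero_le_one
    (Continuous.intervalIntegrable (by fun_prop) _ _)
    (Continuous.intervalIntegrable (by fun_prop) _ _) fun τ hτ => ?_
  exact mul_le_mul_of_nonneg_left (h _ ⟨mul_nonneg hr hτ.1, mul_le_of_le_one_right hr hτ.2⟩)
    (pow_nonneg hτ.1 m)

theorem ballAvg_const_le {m : ℕ} {c r : ℝ} (hc : 0 ≤ c) : ballAvg m (fun _ => c) r ≤ c := by
  simp only [ballAvg, intervalIntegral.integral_mul_const, integral_pow]
  simp only [one_pow, ne_eq, Nat.add_eq_zero_iff, one_ne_zero, and_false, not_false_eq_true,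
    zero_pow, sub_zero]
  refine mul_le_of_le_one_left hc ?_
  rw [div_le_one (by positivity)]
  have : (0 : ℝ) ≤ m := by positivity
  linarith

theorem ballAvg_le {m : ℕ} {g : ℝ → ℝ} (hg : Continuous g) {c r : ℝ} (hc : 0 ≤ c)
    (hr : 0 ≤ r) (h : ∀ t ∈ Icc 0 r, g t ≤ c) : ballAvg m g r ≤ c :=
  (ballAvg_mono hg continuous_const hr h).trans (ballAvg_const_le hc)

theorem ballAvg_pos {m : ℕ} {g : ℝ → ℝ} (hg : Continuous g) {r : ℝ}
    (hr : 0 ≤ r) (h : ∀ t ∈ Icc 0 r, 0 ≤ g t) (h0 : 0 < g 0) : 0 < ballAvg m g r := by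
  have hev : ∀ᶠ τ in 𝓝[>] (0 : ℝ), 0 < g (r * τ) := by
    have : Tendsto (fun τ => g (r * τ)) (𝓝 0) (𝓝 (g (r * 0))) :=
      Continuous.tendsto (by fun_prop) 0
    rw [mul_zero] at this
    exact (this.mono_left nhdsWithin_le_nhds).eventually_const_lt h0
  obtain ⟨τ, hτ, hτ1⟩ := (hev.and (Ioo_mem_nhdsGT (zero_lt_one' ℝ))).exists
  refine intervalIntegral.integral_pos zero_lt_one (Continuous.continuousOn (by fun_prop))
    (fun τ hτ => ?_) ⟨τ, Ioo_subset_Icc_self hτ1, ?_⟩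
  · exact mul_nonneg (pow_nonneg hτ.1.le m)
      (h _ ⟨mul_nonneg hr hτ.1.le, mul_le_of_le_one_right hr hτ.2⟩)
  · exact mul_pos (pow_pos hτ1.1 m) hτ

theorem abs_ballAvg_sub_le {m : ℕ} {g₁ g₂ : ℝ → ℝ} (h₁ : Continuous g₁) (h₂ : Continuous g₂)
    {c r : ℝ} (hr : 0 ≤ r) (h : ∀ t ∈ Icc 0 r, |g₁ t - g₂ t| ≤ c) :
    |ballAvg m g₁ r - ballAvg m g₂ r| ≤ c := by
  have e : ballAvg m g₁ r - ballAvg m g₂ r = ∫ τ in (0 : ℝ)..1, τ ^ m * (g₁ (r * τ) - g₂ (r * τ)) := by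
    simp only [mul_sub]
    exact (intervalIntegral.integral_sub (Continuous.intervalIntegrable (by fun_prop) _ _)
      (Continuous.intervalIntegrable (by fun_prop) _ _)).symm
  have hb := intervalIntegral.norm_integral_le_of_norm_le_const (a := 0) (b := 1) (C := c)
    (f := fun τ => τ ^ m * (g₁ (r * τ) - g₂ (r * τ))) ?_
  · rw [e]; simpa using hb
  · intro τ hτ
    rw [uIoc_of_le zero_le_one] at hτ
    rw [norm_mul, Real.norm_eq_abs, Real.norm_eq_abs, abs_of_nonneg (pow_nonneg hτ.1.le m)]
    refine le_trans (mul_le_of_le_one_left (abs_nonneg _) (pow_le_one₀ hτ.1.le hτ.2)) ?_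
    exact h _ ⟨mul_nonneg hr hτ.1.le, mul_le_of_le_one_right hr hτ.2⟩

/-- Global solvability and continuous dependence on `d` for the integral form of the radial
initial value problem with Lipschitz nonlinearities. -/
theorem exists_integral_solution (m : ℕ) {k f ψ : ℝ → ℝ} {Lf Lψ : NNReal} {R : ℝ} (hR : 0 < R)
    (hk : Continuous k) (hf : LipschitzWith Lf f) (hψ : LipschitzWith Lψ ψ) :
    ∃ U : ℝ → ℝ → ℝ, (∀ r ∈ Icc 0 R, Continuous fun d => U d r) ∧ (∀ d, Continuous (U d)) ∧
      ∀ d r, U d r = d - ∫ s in (0 : ℝ)..r, ψ (s * ballAvg m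
        (fun t => k (projIcc 0 R hR.le t) * f (U d (projIcc 0 R hR.le t))) s) := by
  obtain ⟨M, hM⟩ : ∃ M, ∀ t ∈ Icc 0 R, |k t| ≤ M := by
    obtain ⟨M, hM⟩ := isCompact_Icc.exists_bound_of_continuousOn (s := Icc 0 R) hk.continuousOn
    exact ⟨M, fun t ht => hM t ht⟩
  have hM0 : 0 ≤ M := (abs_nonneg _).trans (hM 0 ⟨le_rfl, hR.le⟩)
  have hfc := hf.continuous
  have hψc := hψ.continuous
  set L : ℝ := Lψ * (R * (M * Lf)) with hL
  have hL0 : 0 ≤ L := by positivity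
  -- With weight exp(lam r) the Lipschitz constant becomes L / lam ≤ 1/2, whatever the length R.
  set lam : ℝ := 2 * L + 1 with hlam
  have hlam0 : 0 < lam := by positivity
  -- The unknown v is U divided by exp(lam r), so the sup distance of v is a weighted distance of U.
  -- The projection extends functions constantly outside [0, R].
  let E : C(Icc 0 R, ℝ) → ℝ → ℝ := fun v t =>
    Real.exp (lam * projIcc 0 R hR.le t) * v (projIcc 0 R hR.le t)
  have hE : ∀ v, Continuous (E v) := fun v => by
    have : Continuous fun t => (projIcc 0 R hR.le t : ℝ) :=
      continuous_subtype_val.comp continuous_projIcc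
    have h2 : Continuous fun t => v (projIcc 0 R hR.le t) := v.continuous.comp continuous_projIcc
    fun_prop
  let g : C(Icc 0 R, ℝ) → ℝ → ℝ := fun v t => k (projIcc 0 R hR.le t) * f (E v t)
  have hg : ∀ v, Continuous (g v) := fun v => by
    have : Continuous fun t => (projIcc 0 R hR.le t : ℝ) :=
      continuous_subtype_val.comp continuous_projIcc
    have := hE v
    exact (hk.comp ‹_›).mul (hfc.comp this)
  let H : C(Icc 0 R, ℝ) → ℝ → ℝ := fun v s => ψ (s * ballAvg m (g v) s)
  have hH : ∀ v, Continuous (H v) := fun v =>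
    hψc.comp (continuous_id.mul (continuous_ballAvg (hg v)))
  let I : C(Icc 0 R, ℝ) → ℝ → ℝ := fun v r => ∫ s in (0 : ℝ)..r, H v s
  have hI : ∀ v, Continuous (I v) := fun v =>
    intervalIntegral.continuous_primitive (fun a b => (hH v).intervalIntegrable a b) 0
  have hIlip : ∀ v v' : C(Icc 0 R, ℝ), ∀ r ∈ Icc 0 R,
      |I v r - I v' r| ≤ 1 / 2 * dist v v' * Real.exp (lam * r) := by
    intro v v' r hr
    have hHd : ∀ s ∈ Icc 0 R, |H v s - H v' s| ≤ L * dist v v' * Real.exp (lam * s) := by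
      intro s hs
      have h1 : |ballAvg m (g v) s - ballAvg m (g v') s| ≤
          M * Lf * (dist v v' * Real.exp (lam * s)) := by
        refine abs_ballAvg_sub_le (hg v) (hg v') hs.1 fun t ht => ?_
        have htR : t ∈ Icc 0 R := ⟨ht.1, ht.2.trans hs.2⟩
        have h2 : |f (E v t) - f (E v' t)| ≤ Lf * |E v t - E v' t| := by
          simpa [Real.dist_eq] using hf.dist_le_mul (E v t) (E v' t)
        have h3 : |E v t - E v' t| ≤ dist v v' * Real.exp (lam * s) := by
          simp only [E]
          rw [← mul_sub, abs_mul, Real.abs_exp, projIcc_of_mem _ htR, mul_comm]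
          have h4 : |v ⟨t, htR⟩ - v' ⟨t, htR⟩| ≤ dist v v' := by
            simpa [Real.dist_eq] using ContinuousMap.dist_apply_le_dist (f := v) (g := v') ⟨t, htR⟩
          have h5 : t ≤ s := ht.2
          gcongr
        simp only [g]
        rw [← mul_sub, abs_mul, projIcc_of_mem _ htR]
        calc |k t| * |f (E v t) - f (E v' t)| ≤ M * (Lf * (dist v v' * Real.exp (lam * s))) := by
              have := hM t htR
              gcongr
              exact h2.trans (by gcongr)
          _ = _ := by ring
      have h6 := hψ.dist_le_mul (s * ballAvg m (g v) s) (s * ballAvg m (g v') s)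
      rw [Real.dist_eq, Real.dist_eq, ← mul_sub, abs_mul, abs_of_nonneg hs.1] at h6
      refine h6.trans ?_
      calc (Lψ : ℝ) * (s * |ballAvg m (g v) s - ballAvg m (g v') s|)
          ≤ Lψ * (R * (M * Lf * (dist v v' * Real.exp (lam * s)))) := by
            have := hs.2
            gcongr
        _ = _ := by rw [hL]; ring
    have h1 : I v r - I v' r = ∫ s in (0 : ℝ)..r, (H v s - H v' s) :=
      (intervalIntegral.integral_sub ((hH v).intervalIntegrable _ _)
        ((hH v').intervalIntegrable _ _)).symm
    have h2 : |I v r - I v' r| ≤ ∫ s in (0 : ℝ)..r, L * dist v v' * Real.exp (lam * s) := by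
      rw [h1, ← Real.norm_eq_abs]
      refine intervalIntegral.norm_integral_le_of_norm_le hr.1 ?_
        (Continuous.intervalIntegrable (by fun_prop) _ _)
      exact Eventually.of_forall fun s hs => hHd s ⟨hs.1.le, hs.2.trans hr.2⟩
    refine h2.trans ?_
    rw [intervalIntegral.integral_const_mul]
    have h3 : ∫ s in (0 : ℝ)..r, Real.exp (lam * s) = lam⁻¹ * (Real.exp (lam * r) - 1) := by
      have := intervalIntegral.integral_comp_mul_left (a := 0) (b := r) (fun x => Real.exp x)
        hlam0.ne'
      simpa using this
    rw [h3]
    have h4 : L * lam⁻¹ ≤ 1 / 2 := by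
      rw [← div_eq_mul_inv, div_le_iff₀ hlam0]; linarith
    have h5 : 0 ≤ dist v v' := dist_nonneg
    have h6 : 0 < Real.exp (lam * r) := Real.exp_pos _
    have h7 : 0 ≤ L * lam⁻¹ := by positivity
    calc L * dist v v' * (lam⁻¹ * (Real.exp (lam * r) - 1))
        = (L * lam⁻¹) * (dist v v' * (Real.exp (lam * r) - 1)) := by ring
      _ ≤ (L * lam⁻¹) * (dist v v' * Real.exp (lam * r)) := by gcongr; linarith
      _ ≤ 1 / 2 * (dist v v' * Real.exp (lam * r)) := by gcongr
      _ = _ := by ring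
  let F : ℝ → C(Icc 0 R, ℝ) → C(Icc 0 R, ℝ) := fun d v =>
    ⟨fun r => Real.exp (-(lam * r)) * (d - I v r), by
      have := (hI v).comp continuous_subtype_val (X := Icc 0 R)
      have h2 : Continuous fun r : Icc (0 : ℝ) R => I v r := this
      fun_prop⟩
  have hF : ∀ d, ContractingWith (1 / 2) (F d) := by
    intro d
    refine ⟨by rw [← NNReal.coe_lt_coe]; norm_num, LipschitzWith.of_dist_le_mul fun v v' => ?_⟩
    rw [ContinuousMap.dist_le (by positivity)]
    intro r
    have h1 : F d v r - F d v' r = -(Real.exp (-(lam * r)) * (I v r - I v' r)) := by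
      simp only [F, ContinuousMap.coe_mk]; ring
    rw [Real.dist_eq, h1, abs_neg, abs_mul, Real.abs_exp]
    calc Real.exp (-(lam * r)) * |I v r - I v' r|
        ≤ Real.exp (-(lam * r)) * (1 / 2 * dist v v' * Real.exp (lam * r)) := by
          gcongr; exact hIlip v v' r r.2
      _ = 1 / 2 * dist v v' * (Real.exp (-(lam * r)) * Real.exp (lam * r)) := by ring
      _ = _ := by rw [← Real.exp_add, neg_add_cancel, Real.exp_zero]; simp
  let V : ℝ → C(Icc 0 R, ℝ) := fun d => ContractingWith.fixedPoint (F d) (hF d)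
  have hV : ∀ d, F d (V d) = V d := fun d => (hF d).fixedPoint_isFixedPt
  -- All `F d` share the contraction constant 1/2 and move by at most |d - d'|, so the fixed points
  -- move by at most 2|d - d'|.
  have hVlip : ∀ d d', dist (V d) (V d') ≤ 2 * |d - d'| := by
    intro d d'
    have h1 := (hF d).fixedPoint_lipschitz_in_map (hF d') (C := |d - d'|) ?_
    · refine h1.trans (le_of_eq ?_)
      push_cast; ring
    · intro v
      rw [ContinuousMap.dist_le (abs_nonneg _)]
      intro r
      have h1 : F d v r - F d' v r = Real.exp (-(lam * r)) * (d - d') := by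
        simp only [F, ContinuousMap.coe_mk]; ring
      rw [Real.dist_eq, h1, abs_mul, Real.abs_exp]
      refine mul_le_of_le_one_left (abs_nonneg _) ?_
      rw [Real.exp_le_one_iff]
      have := mul_nonneg hlam0.le r.2.1
      linarith
  have hVc : Continuous V := by
    have : LipschitzWith 2 V := LipschitzWith.of_dist_le_mul fun d d' => by
      simpa [Real.dist_eq] using hVlip d d'
    exact this.continuous
  have hUV : ∀ d, ∀ r : Icc (0 : ℝ) R, d - I (V d) r = Real.exp (lam * r) * V d r := by
    intro d r
    have h1 : Real.exp (-(lam * r)) * (d - I (V d) r) = V d r :=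
      congrArg (fun v : C(Icc 0 R, ℝ) => v r) (hV d)
    rw [← h1, ← mul_assoc, ← Real.exp_add, add_neg_cancel, Real.exp_zero, one_mul]
  refine ⟨fun d r => d - I (V d) r, ?_, fun d => continuous_const.sub (hI _), ?_⟩
  · intro r hr
    have h1 : (fun d => d - I (V d) r) = fun d => Real.exp (lam * r) * V d ⟨r, hr⟩ :=
      funext fun d => hUV d ⟨r, hr⟩
    simp only [h1]
    exact continuous_const.mul ((continuous_eval_const (F := C(Icc 0 R, ℝ)) _).comp hVc)
  · intro d r
    have h1 : g (V d) = fun t => k (projIcc 0 R hR.le t) *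
        f (d - I (V d) (projIcc 0 R hR.le t)) := by
      funext t
      simp only [g, E, hUV]
    simp only [← h1]
    rfl

/-! ### Radial functions and vector fields on ℝⁿ -/

section Calculus

variable {E : Type*} [NormedAddCommGroup E] [InnerProductSpace ℝ E]

theorem hasFDerivAt_norm_of_ne_zero {x : E} (hx : x ≠ 0) :
    HasFDerivAt (fun y : E => ‖y‖) (‖x‖⁻¹ • innerSL ℝ x) x := by
  have hx' : ‖x‖ ≠ 0 := norm_ne_zero_iff.2 hx
  have h1 := (hasStrictFDerivAt_norm_sq x).hasFDerivAt.sqrt (pow_ne_zero 2 hx')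
  simp only [Real.sqrt_sq (norm_nonneg _)] at h1
  refine h1.congr_fderiv ?_
  ext y
  simp
  field_simp

theorem hasFDerivAt_comp_norm {U : ℝ → ℝ} {U' : ℝ} {x : E} (hx : x ≠ 0)
    (hU : HasDerivAt U U' ‖x‖) :
    HasFDerivAt (fun y : E => U ‖y‖) ((U' / ‖x‖) • innerSL ℝ x) x := by
  have := hU.comp_hasFDerivAt x (hasFDerivAt_norm_of_ne_zero hx)
  refine this.congr_fderiv ?_
  rw [smul_smul, div_eq_mul_inv]

theorem hasGradientAt_comp_norm [CompleteSpace E] {U : ℝ → ℝ} {U' : ℝ} {x : E} (hx : x ≠ 0)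
    (hU : HasDerivAt U U' ‖x‖) :
    HasGradientAt (fun y : E => U ‖y‖) ((U' / ‖x‖) • x) x := by
  rw [hasGradientAt_iff_hasFDerivAt]
  refine (hasFDerivAt_comp_norm hx hU).congr_fderiv ?_
  ext y
  simp

theorem hasGradientAt_comp_norm_zero [CompleteSpace E] {U : ℝ → ℝ} (hU : HasDerivAt U 0 0) :
    HasGradientAt (fun y : E => U ‖y‖) 0 0 := by
  rw [hasGradientAt_iff_isLittleO]
  have h1 := hasDerivAt_iff_isLittleO.1 hU
  have h2 : Tendsto (fun y : E => ‖y‖) (𝓝 0) (𝓝 0) := by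
    simpa using (continuous_norm (E := E)).tendsto 0
  have h3 := h1.comp_tendsto h2
  refine (h3.congr ?_ ?_).trans_isBigO (Asymptotics.isBigO_refl _ _).norm_left
  · intro y; simp
  · intro y; simp

theorem hasFDerivAt_comp_norm_smul {b : ℝ → ℝ} {b' : ℝ} {x : E} (hx : x ≠ 0)
    (hb : HasDerivAt b b' ‖x‖) :
    HasFDerivAt (fun y : E => b ‖y‖ • y) (b ‖x‖ • ContinuousLinearMap.id ℝ E +
      ((b' / ‖x‖) • innerSL ℝ x).smulRight x) x :=
  (hasFDerivAt_comp_norm hx hb).smul (hasFDerivAt_id x)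

/-- Continuity of b at 0 suffices, since (b(|y|) - b(0)) y = o(|y|). This gives differentiability of
the flux at the centre. -/
theorem hasFDerivAt_comp_norm_smul_zero {b : ℝ → ℝ} (hb : ContinuousAt b 0) :
    HasFDerivAt (fun y : E => b ‖y‖ • y) (b 0 • ContinuousLinearMap.id ℝ E) 0 := by
  rw [hasFDerivAt_iff_isLittleO]
  have h1 : Tendsto (fun y : E => b ‖y‖ - b 0) (𝓝 0) (𝓝 0) := by
    have h2 : Tendsto (fun y : E => ‖y‖) (𝓝 0) (𝓝 0) := by
      simpa using (continuous_norm (E := E)).tendsto 0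
    simpa using (hb.tendsto.comp h2).sub_const (b 0)
  have h3 := ((Asymptotics.isLittleO_one_iff ℝ).2 h1).smul_isBigO
    (Asymptotics.isBigO_refl (fun y : E => y) (𝓝 0))
  refine h3.congr (fun y => ?_) (fun y => ?_)
  · simp [sub_smul]
  · simp

end Calculus

theorem divergence_eq_of_hasFDerivAt_radial {n : ℕ}
    {V : EuclideanSpace ℝ (Fin n) → EuclideanSpace ℝ (Fin n)} {x : EuclideanSpace ℝ (Fin n)}
    {β γ : ℝ} (hV : HasFDerivAt V (β • ContinuousLinearMap.id ℝ _ +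
      (γ • innerSL ℝ x).smulRight x) x) :
    divergence V x = n * β + γ * ‖x‖ ^ 2 := by
  unfold divergence
  rw [hV.fderiv, EuclideanSpace.real_norm_sq_eq, Finset.mul_sum]
  simp [EuclideanSpace.inner_single_right, Finset.sum_add_distrib]
  exact Finset.sum_congr rfl fun i _ => by ring

theorem rpow_sub_two_mul_self {p D : ℝ} (hD : D < 0) : |D| ^ (p - 2) * D = -|D| ^ (p - 1) := by
  have h : 0 < |D| := abs_pos.2 hD.ne
  rw [show p - 1 = (p - 2) + 1 by ring, Real.rpow_add_one h.ne']
  nth_rewrite 2 [← neg_neg D]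
  rw [← abs_of_neg hD]; ring

theorem mul_abs_rpow_of_pos {v q : ℝ} (hv : 0 < v) : v * |v| ^ (q - 2) = v ^ (q - 1) := by
  rw [abs_of_pos hv, show q - 1 = (q - 2) + 1 by ring, Real.rpow_add_one hv.ne', mul_comm]

/-- A solution of the radial system that is regular at the centre gives a radial solution of the
Dirichlet problem. -/
theorem isPosRadialSolution_of_profile {n : ℕ} {p R : ℝ} {K U b : ℝ → ℝ} (hp : 1 < p) (hp2 : p ≤ 2)
    (hU : Continuous U) (hb : Continuous b)
    (hbpos : ∀ r ∈ Ico 0 R, 0 < b r)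
    (hUd : ∀ r ∈ Ico 0 R, HasDerivAt U (-(r * b r) ^ (1 / (p - 1))) r)
    (hbd : ∀ r ∈ Ioo 0 R, HasDerivAt b ((K r * U r ^ (critExp n p - 1) - n * b r) / r) r)
    (hb0 : n * b 0 = K 0 * U 0 ^ (critExp n p - 1))
    (hUpos : ∀ r ∈ Ico 0 R, 0 < U r) (hUR : U R = 0) :
    IsPosRadialSolution n p K R (fun x => U ‖x‖) := by
  have hp1 : 0 < p - 1 := by linarith
  have hσ0 : 0 < 1 / (p - 1) := by positivity
  have hσ1 : 0 ≤ 1 / (p - 1) - 1 := by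
    rw [sub_nonneg, le_div_iff₀ hp1]; linarith
  set σ := 1 / (p - 1) with hσ
  -- The gradient of u is -g(|x|) x. As p ≤ 2, the exponent σ - 1 is nonnegative, so g is continuous
  -- at 0 and u is C¹ there.
  set g : ℝ → ℝ := fun r => r ^ (σ - 1) * b r ^ σ with hg
  have hgc : Continuous g :=
    (Real.continuous_rpow_const hσ1).mul (hb.rpow_const fun _ => Or.inr hσ0.le)
  have hmem : ∀ x ∈ Metric.ball (0 : EuclideanSpace ℝ (Fin n)) R, ‖x‖ ∈ Ico 0 R := fun x hx =>
    ⟨norm_nonneg x, by simpa using hx⟩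
  have hgmul : ∀ r ∈ Ico 0 R, 0 < r → (r * b r) ^ σ = r * g r := by
    intro r hr hr0
    rw [Real.mul_rpow hr0.le (hbpos r hr).le, hg]
    simp only
    rw [Real.rpow_sub_one hr0.ne']
    field_simp
  have hgrad : ∀ x ∈ Metric.ball (0 : EuclideanSpace ℝ (Fin n)) R,
      HasGradientAt (fun x => U ‖x‖) (-g ‖x‖ • x) x := by
    intro x hx
    by_cases hx0 : x = 0
    · subst hx0
      have h0 := hUd 0 (by simpa using hmem 0 hx)
      rw [zero_mul, Real.zero_rpow hσ0.ne', neg_zero] at h0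
      simpa using hasGradientAt_comp_norm_zero (E := EuclideanSpace ℝ (Fin n)) h0
    · have hxn : 0 < ‖x‖ := norm_pos_iff.2 hx0
      have h1 := hasGradientAt_comp_norm hx0 (hUd ‖x‖ (hmem x hx))
      rw [hgmul _ (hmem x hx) hxn] at h1
      convert h1 using 2
      field_simp
  have hflux : ∀ x ∈ Metric.ball (0 : EuclideanSpace ℝ (Fin n)) R,
      flux p (fun x => U ‖x‖) x = (-b ‖x‖) • x := by
    intro x hx
    unfold flux
    rw [(hgrad x hx).gradient]
    by_cases hx0 : x = 0
    · simp [hx0]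
    · have hxn : 0 < ‖x‖ := norm_pos_iff.2 hx0
      have hbx := hbpos _ (hmem x hx)
      have hgx : 0 < g ‖x‖ := by rw [hg]; positivity
      rw [norm_smul, norm_neg, Real.norm_of_nonneg hgx.le, smul_smul]
      congr 1
      have h1 : (g ‖x‖ * ‖x‖) ^ (p - 1) = ‖x‖ * b ‖x‖ := by
        rw [mul_comm, ← hgmul _ (hmem x hx) hxn, ← Real.rpow_mul (by positivity), hσ,
          one_div_mul_cancel hp1.ne', Real.rpow_one]
      rw [show p - 1 = (p - 2) + 1 by ring, Real.rpow_add_one (by positivity)] at h1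
      have h2 : ((g ‖x‖ * ‖x‖) ^ (p - 2) * g ‖x‖) * ‖x‖ = b ‖x‖ * ‖x‖ := by linarith
      have h3 := mul_right_cancel₀ hxn.ne' h2
      linarith
  have hfluxev : ∀ x ∈ Metric.ball (0 : EuclideanSpace ℝ (Fin n)) R,
      flux p (fun x => U ‖x‖) =ᶠ[𝓝 x] fun y => (fun r => -b r) ‖y‖ • y := by
    intro x hx
    filter_upwards [Metric.isOpen_ball.mem_nhds hx] with y hy
    exact hflux y hy
  have hfluxd : ∀ x ∈ Metric.ball (0 : EuclideanSpace ℝ (Fin n)) R,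
      HasFDerivAt (flux p (fun x => U ‖x‖)) ((-b ‖x‖) • ContinuousLinearMap.id ℝ _ +
      ((-((K ‖x‖ * U ‖x‖ ^ (critExp n p - 1) - n * b ‖x‖) / ‖x‖) / ‖x‖) •
        innerSL ℝ x).smulRight x) x := by
    intro x hx
    by_cases hx0 : x = 0
    · subst hx0
      have h1 := (hasFDerivAt_comp_norm_smul_zero (E := EuclideanSpace ℝ (Fin n))
        (b := fun r => -b r) hb.neg.continuousAt).congr_of_eventuallyEq (hfluxev 0 hx)
      refine h1.congr_fderiv ?_
      ext y i
      simp
    · have hxn : 0 < ‖x‖ := norm_pos_iff.2 hx0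
      exact (hasFDerivAt_comp_norm_smul (b := fun r => -b r) hx0
        (hbd ‖x‖ ⟨hxn, (hmem x hx).2⟩).neg).congr_of_eventuallyEq (hfluxev x hx)
  refine ⟨fun x _ y _ hxy => by simp only [hxy], (hU.comp continuous_norm).continuousOn, ?_,
    fun x hx => (hfluxd x hx).differentiableAt.differentiableWithinAt, ?_,
    fun x hx => hUpos _ (hmem x hx), fun x hx => ?_⟩
  · have hfd : ∀ x ∈ Metric.ball (0 : EuclideanSpace ℝ (Fin n)) R,
        fderiv ℝ (fun x => U ‖x‖) x = innerSL ℝ (-g ‖x‖ • x) := by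
      intro x hx
      rw [(hasGradientAt_iff_hasFDerivAt.1 (hgrad x hx)).fderiv]
      rfl
    have h1 : ContDiffOn ℝ (0 + 1) (fun x : EuclideanSpace ℝ (Fin n) => U ‖x‖)
        (Metric.ball 0 R) := by
      rw [contDiffOn_succ_iff_fderiv_of_isOpen Metric.isOpen_ball]
      refine ⟨fun x hx => (hgrad x hx).differentiableAt.differentiableWithinAt, by simp, ?_⟩
      rw [contDiffOn_zero]
      refine ContinuousOn.congr (Continuous.continuousOn ?_) hfd
      have : Continuous fun x : EuclideanSpace ℝ (Fin n) => g ‖x‖ := hgc.comp continuous_norm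
      fun_prop
    simpa using h1
  · intro x hx
    unfold pLaplacian
    rw [divergence_eq_of_hasFDerivAt_radial (hfluxd x hx), mul_abs_rpow_of_pos (hUpos _ (hmem x hx))]
    by_cases hx0 : x = 0
    · subst hx0
      simp only [norm_zero]
      rw [← hb0]; ring
    · have hxn : ‖x‖ ≠ 0 := norm_ne_zero_iff.2 hx0
      field_simp
      ring
  · have : ‖x‖ = R := by simpa using hx
    simp only [this, hUR]

/-- A radial solution of the Dirichlet problem gives a profile on `(0, R)`. -/
theorem IsPosRadialSolution.exists_profile {n : ℕ} {p R : ℝ} {K : ℝ → ℝ} (hp : 1 < p)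
    (hpn : p < n) (hR : 0 < R) (hK : ∀ r ∈ Ioo 0 R, 0 < K r)
    {u : EuclideanSpace ℝ (Fin n) → ℝ} (h : IsPosRadialSolution n p K R u) :
    ∃ d U b, RadialProfile n p K R d U b ∧ Tendsto U (𝓝[<] R) (𝓝 0) := by
  have hn2 := two_le_of_lt hp hpn
  have hp1 : 0 < p - 1 := by linarith
  obtain ⟨e, he⟩ : ∃ e : EuclideanSpace ℝ (Fin n), ‖e‖ = 1 :=
    ⟨EuclideanSpace.single ⟨0, by omega⟩ 1, by simp⟩
  have hee : inner ℝ e e = (1 : ℝ) := by rw [real_inner_self_eq_norm_sq, he]; norm_num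
  have hnre : ∀ r : ℝ, 0 ≤ r → ‖r • e‖ = r := fun r hr => by
    rw [norm_smul, he, mul_one, Real.norm_of_nonneg hr]
  have hball : ∀ r ∈ Ico 0 R, r • e ∈ Metric.ball (0 : EuclideanSpace ℝ (Fin n)) R :=
    fun r hr => by rw [mem_ball_zero_iff, hnre r hr.1]; exact hr.2
  have hcball : ∀ r ∈ Icc 0 R, r • e ∈ Metric.closedBall (0 : EuclideanSpace ℝ (Fin n)) R :=
    fun r hr => by rw [mem_closedBall_zero_iff, hnre r hr.1]; exact hr.2
  have hline : ∀ r : ℝ, HasDerivAt (fun t : ℝ => t • e) e r := fun r => by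
    simpa using (hasDerivAt_id r).smul_const e
  have hlinec : Continuous fun t : ℝ => t • e := by fun_prop
  set U : ℝ → ℝ := fun r => u (r • e) with hUdef
  -- Reading b off the flux along a ray gives its differentiability from that of the flux, without a
  -- second derivative of U.
  set b : ℝ → ℝ := fun r => -inner ℝ (flux p u (r • e)) e / r with hbdef
  set D : ℝ → ℝ := fun r => inner ℝ (gradient u (r • e)) e with hDdef
  have hUnorm : ∀ x ∈ Metric.ball (0 : EuclideanSpace ℝ (Fin n)) R, u x = U ‖x‖ := by
    intro x hx
    have hx' : ‖x‖ < R := by simpa using hx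
    exact h.radial x (Metric.ball_subset_closedBall hx) _
      (hcball _ ⟨norm_nonneg x, hx'.le⟩) (hnre _ (norm_nonneg x)).symm
  have hudiff : ∀ x ∈ Metric.ball (0 : EuclideanSpace ℝ (Fin n)) R, DifferentiableAt ℝ u x :=
    fun x hx => (h.contDiff.differentiableOn one_ne_zero).differentiableAt
      (Metric.isOpen_ball.mem_nhds hx)
  have hUD : ∀ r ∈ Ico 0 R, HasDerivAt U (D r) r := by
    intro r hr
    have h1 := (hudiff _ (hball r hr)).hasFDerivAt.comp_hasDerivAt r (hline r)
    rw [← inner_gradient_left] at h1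
    exact h1
  have hgrad : ∀ x ∈ Metric.ball (0 : EuclideanSpace ℝ (Fin n)) R, x ≠ 0 →
      gradient u x = (D ‖x‖ / ‖x‖) • x := by
    intro x hx hx0
    have hx' : ‖x‖ < R := by simpa using hx
    have h1 := hasGradientAt_comp_norm hx0 (hUD ‖x‖ ⟨norm_nonneg x, hx'⟩)
    refine (h1.congr_of_eventuallyEq ?_).gradient
    filter_upwards [Metric.isOpen_ball.mem_nhds hx] with y hy
    exact hUnorm y hy
  have hflux : ∀ x ∈ Metric.ball (0 : EuclideanSpace ℝ (Fin n)) R, x ≠ 0 →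
      flux p u x = (|D ‖x‖| ^ (p - 2) * D ‖x‖ / ‖x‖) • x := by
    intro x hx hx0
    have hxn : ‖x‖ ≠ 0 := norm_ne_zero_iff.2 hx0
    unfold flux
    rw [hgrad x hx hx0, norm_smul, norm_div, norm_norm, div_mul_cancel₀ _ hxn, smul_smul,
      Real.norm_eq_abs, mul_div_assoc]
  have hbD : ∀ r ∈ Ioo 0 R, r * b r = -(|D r| ^ (p - 2) * D r) := by
    intro r hr
    have hr0 : r ≠ 0 := hr.1.ne'
    have hne : r • e ≠ 0 := by rw [← norm_ne_zero_iff, hnre r hr.1.le]; exact hr0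
    simp only [hbdef]
    rw [hflux _ (hball r ⟨hr.1.le, hr.2⟩) hne, hnre r hr.1.le, smul_smul, inner_smul_left, hee]
    simp
    field_simp
  have hfluxb : ∀ x ∈ Metric.ball (0 : EuclideanSpace ℝ (Fin n)) R, x ≠ 0 →
      flux p u x = (fun r => -b r) ‖x‖ • x := by
    intro x hx hx0
    have hxn : 0 < ‖x‖ := norm_pos_iff.2 hx0
    have h1 := hbD ‖x‖ ⟨hxn, by simpa using hx⟩
    rw [hflux x hx hx0]
    congr 1
    rw [div_eq_iff hxn.ne']
    linarith
  have hfdiff : ∀ x ∈ Metric.ball (0 : EuclideanSpace ℝ (Fin n)) R,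
      DifferentiableAt ℝ (flux p u) x :=
    fun x hx => h.flux_diff.differentiableAt (Metric.isOpen_ball.mem_nhds hx)
  have hUpos : ∀ r ∈ Ioo 0 R, 0 < U r := fun r hr => h.pos _ (hball r ⟨hr.1.le, hr.2⟩)
  have hbd : ∀ r ∈ Ioo 0 R,
      HasDerivAt b ((K r * U r ^ (critExp n p - 1) - n * b r) / r) r := by
    intro r hr
    have hr0 : r ≠ 0 := hr.1.ne'
    have hrb := hball r ⟨hr.1.le, hr.2⟩
    have hne : r • e ≠ 0 := by rw [← norm_ne_zero_iff, hnre r hr.1.le]; exact hr0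
    have hbdiff : DifferentiableAt ℝ b r := by
      have h1 : DifferentiableAt ℝ (fun t : ℝ => flux p u (t • e)) r :=
        DifferentiableAt.comp (g := flux p u) (f := fun t : ℝ => t • e) r (hfdiff _ hrb) (hline r).differentiableAt
      exact ((h1.inner ℝ (differentiableAt_const e)).neg).div differentiableAt_id hr0
    have h1 : HasDerivAt (fun t => -b t) (-deriv b r) ‖r • e‖ := by
      rw [hnre r hr.1.le]; exact hbdiff.hasDerivAt.neg
    have hev : flux p u =ᶠ[𝓝 (r • e)] fun y => (fun r => -b r) ‖y‖ • y := by
      filter_upwards [Metric.isOpen_ball.mem_nhds hrb, isOpen_ne.mem_nhds hne] with y hy hy0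
      exact hfluxb y hy hy0
    have h2 := divergence_eq_of_hasFDerivAt_radial
      ((hasFDerivAt_comp_norm_smul hne h1).congr_of_eventuallyEq hev)
    have h3 := h.eqn _ hrb
    unfold pLaplacian at h3
    rw [h2, mul_abs_rpow_of_pos (h.pos _ hrb), hnre r hr.1.le] at h3
    refine hbdiff.hasDerivAt.congr_deriv ?_
    rw [eq_div_iff hr0]
    have h4 : -deriv b r / r * r ^ 2 = -(deriv b r * r) := by field_simp
    rw [h4] at h3
    simp only [hUdef]
    linarith
  have hw : Tendsto (fun r => r ^ n * b r) (𝓝[>] 0) (𝓝 0) := by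
    have h1 : ContinuousAt (fun r : ℝ => -(r ^ (n - 1) * inner ℝ (flux p u (r • e)) e)) 0 := by
      have h2 : ContinuousAt (fun t : ℝ => flux p u (t • e)) 0 :=
        ContinuousAt.comp (g := flux p u) (f := fun t : ℝ => t • e)
          (hfdiff _ (hball 0 ⟨le_rfl, hR⟩)).continuousAt hlinec.continuousAt
      exact ((continuousAt_id.pow (n - 1)).mul (h2.inner continuousAt_const)).neg
    have h2 := h1.tendsto
    rw [zero_pow (by omega), zero_mul, neg_zero] at h2
    refine (h2.mono_left nhdsWithin_le_nhds).congr' ?_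
    filter_upwards [self_mem_nhdsWithin] with r hr
    have hr0 : r ≠ 0 := (mem_Ioi.1 hr).ne'
    obtain ⟨j, rfl⟩ : ∃ j, n = j + 1 := ⟨n - 1, by omega⟩
    simp only [hbdef, Nat.add_sub_cancel]
    field_simp
    ring
  have hbpos : ∀ r ∈ Ioo 0 R, 0 < b r := fun r hr => pos_of_pow_mul_tendsto_zero hbd
    (fun t ht => mul_pos (hK t ht) (Real.rpow_pos_of_pos (hUpos t ht) _)) hw hr
  refine ⟨u 0, U, b, ⟨?_, hw, hUpos, ?_, hbd⟩, ?_⟩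
  · have h1 : ContinuousAt U 0 := (hUD 0 ⟨le_rfl, hR⟩).continuousAt
    have h2 := h1.tendsto
    simp only [hUdef, zero_smul] at h2
    exact h2.mono_left nhdsWithin_le_nhds
  · intro r hr
    refine (hUD r ⟨hr.1.le, hr.2⟩).congr_deriv ?_
    have h1 := hbD r hr
    have h2 : 0 < r * b r := mul_pos hr.1 (hbpos r hr)
    -- Positivity of b forces U' < 0, which allows |U'|^(p-1) = r b to be solved for U'.
    have hD : D r < 0 := by
      by_contra hcon
      have : 0 ≤ |D r| ^ (p - 2) * D r := mul_nonneg (by positivity) (not_lt.1 hcon)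
      linarith
    rw [h1, rpow_sub_two_mul_self hD, neg_neg, ← Real.rpow_mul (abs_nonneg _),
      mul_one_div_cancel hp1.ne', Real.rpow_one, abs_of_neg hD, neg_neg]
  · have h1 : ContinuousWithinAt U (Icc 0 R) R :=
      ContinuousWithinAt.comp (h.cont _ (hcball R ⟨hR.le, le_rfl⟩))
        hlinec.continuousWithinAt hcball
    have h2 := h1.tendsto
    have h3 : U R = 0 := h.boundary _ (by rw [mem_sphere_zero_iff_norm, hnre R hR.le])
    rw [h3] at h2
    have h4 : 𝓝[<] R ≤ 𝓝[Icc 0 R] R :=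
      nhdsWithin_le_of_mem (mem_of_superset (Ioo_mem_nhdsLT hR) Ioo_subset_Icc_self)
    exact h2.mono_left h4

/-! ### Truncation, shooting and the two halves of the theorem -/

/-- The power `x ↦ x^s` truncated outside `[0, D]`. -/
def clampPow (D s x : ℝ) : ℝ := max 0 (min D x) ^ s

theorem clampPow_nonneg (D s x : ℝ) : 0 ≤ clampPow D s x :=
  Real.rpow_nonneg (le_max_left _ _) _

theorem clampPow_of_le {D s x : ℝ} (h : x ≤ D) : clampPow D s x = max 0 x ^ s := by
  rw [clampPow, min_eq_right h]

theorem clampPow_of_mem {D s x : ℝ} (h : x ∈ Icc 0 D) : clampPow D s x = x ^ s := by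
  rw [clampPow_of_le h.2, max_eq_right h.1]

/-- For s ≥ 1 the power has bounded derivative on [0, D], and the truncation is a 1-Lipschitz
projection. It is applied with s = q - 1 and s = σ. -/
theorem exists_lipschitzWith_clampPow {D s : ℝ} (hD : 0 ≤ D) (hs : 1 ≤ s) :
    ∃ L : NNReal, LipschitzWith L (clampPow D s) := by
  have h1 : LipschitzOnWith (s * D ^ (s - 1)).toNNReal (fun x : ℝ => x ^ s) (Icc 0 D) := by
    refine (convex_Icc 0 D).lipschitzOnWith_of_nnnorm_deriv_le
      (fun x _ => (Real.hasDerivAt_rpow_const (Or.inr hs)).differentiableAt) fun x hx => ?_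
    rw [(Real.hasDerivAt_rpow_const (Or.inr hs)).deriv, ← NNReal.coe_le_coe, coe_nnnorm,
      Real.coe_toNNReal _ (by positivity), Real.norm_of_nonneg
      (mul_nonneg (by linarith) (Real.rpow_nonneg hx.1 _))]
    exact mul_le_mul_of_nonneg_left (Real.rpow_le_rpow hx.1 hx.2 (by linarith)) (by linarith)
  have h2 : LipschitzWith 1 fun x => (projIcc 0 D hD x : ℝ) := by
    have := (LipschitzWith.subtype_val (Icc 0 D)).comp (LipschitzWith.projIcc hD)
    rw [one_mul] at this
    exact this
  refine ⟨_, lipschitzOnWith_univ.1 (h1.comp h2.lipschitzOnWith fun x _ => (projIcc 0 D hD x).2)⟩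

/-- Near the origin, `K` is bounded above and below and `K'` is of exact order `r^{ℓ-1}`. -/
theorem HasFlatness.exists_bounds {K : ℝ → ℝ} {ℓ : ℝ} (hK : Admissible K) (h : HasFlatness K ℓ) :
    ∃ A M c C ρ : ℝ, 0 < A ∧ 0 < M ∧ 0 < c ∧ 0 < C ∧ 0 < ρ ∧ ρ ≤ 1 ∧ ∀ r ∈ Ioo 0 ρ,
      A ≤ K r ∧ K r ≤ M ∧ DifferentiableAt ℝ K r ∧
      c * r ^ (ℓ - 1) ≤ deriv K r ∧ deriv K r ≤ C * r ^ (ℓ - 1) := by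
  obtain ⟨hℓ, A, B, hA, hB, h, hKh, hlim⟩ := h
  have hBℓ : 0 < B * ℓ / 2 := by positivity
  -- The bound B keeps K between A and A + 2B; the bound Bℓ/2 keeps K' at least half of Bℓ r^(ℓ-1).
  have hev := hlim.eventually_lt_const (lt_min hB hBℓ)
  obtain ⟨ρ₀, hρ₀, hsub⟩ := mem_nhdsGT_iff_exists_Ioo_subset.1 hev
  refine ⟨A, A + 2 * B, B * ℓ / 2, 2 * (B * ℓ), min ρ₀ 1, hA, by positivity, hBℓ, by positivity,
    lt_min hρ₀ one_pos, min_le_right _ _, fun r hr => ?_⟩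
  have hr0 := hr.1
  have hr1 : r < 1 := hr.2.trans_le (min_le_right _ _)
  have hrℓ : 0 < r ^ ℓ := by positivity
  have hlt : (|h r| + r * |deriv h r|) / r ^ ℓ < min B (B * ℓ / 2) :=
    hsub ⟨hr0, hr.2.trans_le (min_le_left _ _)⟩
  have hlt1 := hlt.trans_le (min_le_left _ _)
  have hlt2 := hlt.trans_le (min_le_right _ _)
  rw [div_lt_iff₀ hrℓ] at hlt1 hlt2
  have hab := abs_nonneg (h r)
  have habd : 0 ≤ r * |deriv h r| := by positivity
  have hh : |h r| ≤ B * r ^ ℓ := by linarith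
  have hh' : |deriv h r| ≤ B * ℓ / 2 * r ^ (ℓ - 1) := by
    rw [Real.rpow_sub_one hr0.ne', ← mul_div_assoc, le_div_iff₀ hr0]
    linarith
  have hKd : DifferentiableAt ℝ K r :=
    (hK.contDiff.differentiableOn one_ne_zero).differentiableAt (Ioi_mem_nhds hr0)
  have hhd : deriv h r = deriv K r - B * (ℓ * r ^ (ℓ - 1)) := by
    have h1 : h =ᶠ[𝓝 r] fun t => K t - (A + B * t ^ ℓ) := by
      filter_upwards [Ioi_mem_nhds hr0] with t ht
      rw [hKh t (mem_Ioi.1 ht).le]; ring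
    have h2 := hKd.hasDerivAt.sub
      (((Real.hasDerivAt_rpow_const (p := ℓ) (Or.inl hr0.ne')).const_mul B).const_add A)
    exact (h2.congr_of_eventuallyEq h1).deriv
  have hrℓ1 : r ^ ℓ ≤ 1 := Real.rpow_le_one hr0.le hr1.le hℓ.le
  rw [abs_le] at hh hh'
  have hKr := hKh r hr0.le
  have hrm : 0 < r ^ (ℓ - 1) := by positivity
  have hBr : 0 < B * ℓ * r ^ (ℓ - 1) := by positivity
  refine ⟨by linarith, ?_, hKd, by linarith, by linarith⟩
  have : B * r ^ ℓ ≤ B := mul_le_of_le_one_right hB.le hrℓ1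
  linarith

/-- The radial initial value problem on `[0, R]` with `U(0) = d ∈ (0, D]`, the nonlinearity being
extended by `0` to negative values. -/
theorem exists_shooting_family {n : ℕ} {p : ℝ} (hp : 1 < p) (hp2 : p ≤ 2) (hn : n ≠ 0)
    (hq2 : 2 ≤ critExp n p) {K : ℝ → ℝ} (hK : Admissible K) {R D : ℝ} (hR : 0 < R) (hD : 0 < D) :
    ∃ (M : ℝ) (U b : ℝ → ℝ → ℝ), 0 < M ∧ (∀ r ∈ Icc 0 R, K r ≤ M) ∧
      (Continuous fun d => U d R) ∧
      ∀ d ∈ Ioc 0 D, Continuous (U d) ∧ Continuous (b d) ∧ U d 0 = d ∧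
        n * b d 0 = K 0 * d ^ (critExp n p - 1) ∧
        (∀ r ∈ Icc 0 R, 0 < b d r ∧ b d r ≤ M * d ^ (critExp n p - 1) ∧
          HasDerivAt (U d) (-(r * b d r) ^ (1 / (p - 1))) r) ∧
        ∀ r ∈ Ioo 0 R,
          HasDerivAt (b d) ((K r * max 0 (U d r) ^ (critExp n p - 1) - n * b d r) / r) r := by
  obtain ⟨m, rfl⟩ := Nat.exists_eq_succ_of_ne_zero hn
  rw [Nat.succ_eq_add_one] at *
  set q := critExp (m + 1) p with hq
  have hp1 : 0 < p - 1 := by linarith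
  have hσ1 : 1 ≤ 1 / (p - 1) := by rw [le_div_iff₀ hp1]; linarith
  set σ := 1 / (p - 1) with hσ
  obtain ⟨M, hM⟩ : ∃ M, ∀ t ∈ Icc 0 R, K t ≤ M := by
    obtain ⟨M, hM⟩ := isCompact_Icc.exists_bound_of_continuousOn (s := Icc 0 R)
      (hK.cont.mono Icc_subset_Ici_self)
    exact ⟨M, fun t ht => (le_abs_self _).trans (hM t ht)⟩
  have hM0 : 0 < M := (hK.pos 0 le_rfl).trans_le (hM 0 ⟨le_rfl, hR.le⟩)
  -- W bounds r b a priori when d ≤ D, and U ≤ d ≤ D since U decreases. Hence neither upper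
  -- truncation is active, and only the positive part of U remains.
  set W := R * (M * D ^ (q - 1)) with hW
  obtain ⟨Lf, hLf⟩ := exists_lipschitzWith_clampPow (s := q - 1) hD.le (by linarith)
  obtain ⟨Lψ, hLψ⟩ := exists_lipschitzWith_clampPow (D := W) (s := σ) (by positivity) hσ1
  have hk : Continuous fun t => K (max t 0) :=
    hK.cont.comp_continuous (by fun_prop) fun t => le_max_right t 0
  obtain ⟨U, hUR, hUc, hU⟩ := exists_integral_solution m hR hk hLf hLψ
  set π : ℝ → ℝ := fun t => (projIcc 0 R hR.le t : ℝ) with hπ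
  have hπc : Continuous π := continuous_subtype_val.comp continuous_projIcc
  have hπe : ∀ t ∈ Icc 0 R, π t = t := fun t ht => by simp only [hπ, projIcc_of_mem _ ht]
  set g : ℝ → ℝ → ℝ := fun d t => K (max (π t) 0) * clampPow D (q - 1) (U d (π t)) with hg
  have hgc : ∀ d, Continuous (g d) := fun d =>
    (hk.comp hπc).mul (hLf.continuous.comp ((hUc d).comp hπc))
  have hgK : ∀ d, ∀ t ∈ Icc 0 R, g d t = K t * clampPow D (q - 1) (U d t) := fun d t ht => by
    simp only [hg, hπe t ht, max_eq_left ht.1]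
  have hg0 : ∀ d t, 0 ≤ g d t := fun d t =>
    mul_nonneg (hK.pos _ (le_max_right _ _)).le (clampPow_nonneg _ _ _)
  refine ⟨M, U, fun d => ballAvg m (g d), hM0, hM, hUR R ⟨hR.le, le_rfl⟩, fun d hd => ?_⟩
  have hUder : ∀ r, HasDerivAt (U d) (-clampPow W σ (r * ballAvg m (g d) r)) r := by
    intro r
    have h1 : Continuous fun s => clampPow W σ (s * ballAvg m (g d) s) :=
      hLψ.continuous.comp (continuous_id.mul (continuous_ballAvg (hgc d)))
    have h2 := (h1.integral_hasStrictDerivAt 0 r).hasDerivAt.const_sub d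
    exact h2.congr_of_eventuallyEq (Eventually.of_forall fun r => hU d r)
  have hU0 : U d 0 = d := by rw [hU]; simp
  have hanti : Antitone (U d) := antitone_of_hasDerivAt_nonpos hUder fun r =>
    neg_nonpos.2 (clampPow_nonneg _ _ _)
  have hUle : ∀ r, 0 ≤ r → U d r ≤ d := fun r hr => (hanti hr).trans_eq hU0
  have hgle : ∀ t ∈ Icc 0 R, g d t ≤ M * d ^ (q - 1) := by
    intro t ht
    rw [hgK d t ht, clampPow_of_le ((hUle t ht.1).trans hd.2)]
    have := hM t ht
    have := hUle t ht.1
    exact mul_le_mul (hM t ht) (Real.rpow_le_rpow (le_max_left _ _) (max_le hd.1.le this)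
      (by linarith)) (Real.rpow_nonneg (le_max_left _ _) _) hM0.le
  have hd0 := hd.1
  have hg00 : g d 0 = K 0 * d ^ (q - 1) := by
    rw [hgK d 0 ⟨le_rfl, hR.le⟩, hU0, clampPow_of_mem ⟨hd.1.le, hd.2⟩]
  refine ⟨hUc d, continuous_ballAvg (hgc d), hU0, ?_, fun r hr => ?_, fun r hr => ?_⟩
  · simp only [ballAvg_zero, hg00]
    push_cast
    field_simp
  · have hpos : 0 < ballAvg m (g d) r := ballAvg_pos (hgc d) hr.1 (fun t _ => hg0 d t)
      (by rw [hg00]; have := hK.pos 0 le_rfl; positivity)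
    have hle : ballAvg m (g d) r ≤ M * d ^ (q - 1) :=
      ballAvg_le (hgc d) (by positivity) hr.1 fun t ht => hgle t ⟨ht.1, ht.2.trans hr.2⟩
    refine ⟨hpos, hle, (hUder r).congr_deriv ?_⟩
    rw [clampPow_of_mem ⟨mul_nonneg hr.1 hpos.le, ?_⟩]
    have hdD : d ^ (q - 1) ≤ D ^ (q - 1) := Real.rpow_le_rpow hd0.le hd.2 (by linarith)
    exact mul_le_mul hr.2 (hle.trans (mul_le_mul_of_nonneg_left hdD hM0.le)) hpos.le hR.le
  · have h1 := hasDerivAt_ballAvg (m := m) (hgc d) hr.1.ne'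
    rw [hgK d r (Ioo_subset_Icc_self hr), clampPow_of_le ((hUle r hr.1.le).trans hd.2)] at h1
    refine h1.congr_deriv ?_
    push_cast
    rfl

/-- Shooting on d. For small d, (q-1)σ > 1 makes the drop of U over [0, R] of order o(d), so U(R) >
0. For a suitable large D, U(R) > 0 would produce a profile that cannot exist. Strict decrease makes
a zero at R the first one. -/
theorem exists_isPosRadialSolution {n : ℕ} {p : ℝ} (hp1 : 1 < p) (hpn : p < n)
    (hq2 : 2 ≤ critExp n p) (hp2 : p ≤ 2) {K : ℝ → ℝ} (hK : Admissible K) {ℓ : ℝ}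
    (hℓ : HasFlatness K ℓ) (hlt : ℓ < flatThreshold n p) {R : ℝ} (hR : 0 < R) :
    ∃ u, IsPosRadialSolution n p K R u := by
  have hn : n ≠ 0 := by have := two_le_of_lt hp1 hpn; omega
  have hpos1 : 0 < p - 1 := by linarith
  obtain ⟨A, M₀, c, C, ρ, hA, -, hc, -, hρ, -, hb⟩ := hℓ.exists_bounds hK
  have hρR : 0 < min ρ R := lt_min hρ hR
  have hbd : ∀ r ∈ Ioo 0 (min ρ R), r ∈ Ioo 0 ρ := fun r hr =>
    ⟨hr.1, hr.2.trans_le (min_le_left _ _)⟩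
  obtain ⟨D, hDnot, hD0⟩ := ((RadialProfile.eventually_not_radialProfile hp1 hpn hA hc hℓ.1 hlt hρR
    (fun r hr => (hb r (hbd r hr)).1) (fun r hr => (hb r (hbd r hr)).2.1)
    (fun r hr => (hb r (hbd r hr)).2.2.1) (fun r hr => (hb r (hbd r hr)).2.2.2.1)).and
    (eventually_gt_atTop 0)).exists
  obtain ⟨M, U, b, hM0, -, hUR, hfam⟩ := exists_shooting_family hp1 hp2 hn hq2 hK hR hD0
  have hσ0 : 0 < 1 / (p - 1) := by positivity
  have hanti : ∀ d ∈ Ioc 0 D, StrictAntiOn (U d) (Icc 0 R) := by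
    intro d hd
    obtain ⟨hUc, hbc, hU0, hb0, hder, hbder⟩ := hfam d hd
    refine strictAntiOn_of_deriv_neg (convex_Icc 0 R) hUc.continuousOn fun r hr => ?_
    rw [interior_Icc] at hr
    obtain ⟨h1, -, h2⟩ := hder r (Ioo_subset_Icc_self hr)
    rw [h2.deriv]
    have := hr.1
    have : 0 < (r * b d r) ^ (1 / (p - 1)) := by positivity
    linarith
  have hDR : U D R ≤ 0 := by
    by_contra hcon
    rw [not_le] at hcon
    obtain ⟨hUc, hbc, hU0, hb0, hder, hbder⟩ := hfam D ⟨hD0, le_rfl⟩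
    have hUpos : ∀ r ∈ Icc 0 R, 0 < U D r := fun r hr =>
      hcon.trans_le ((hanti D ⟨hD0, le_rfl⟩).antitoneOn hr ⟨hR.le, le_rfl⟩ hr.2)
    have hsub : ∀ r ∈ Ioo 0 (min ρ R), r ∈ Ioo 0 R := fun r hr =>
      ⟨hr.1, hr.2.trans_le (min_le_right _ _)⟩
    refine hDnot (U D) (b D) ⟨?_, ?_, fun r hr => hUpos r (Ioo_subset_Icc_self (hsub r hr)),
      fun r hr => (hder r (Ioo_subset_Icc_self (hsub r hr))).2.2, fun r hr => ?_⟩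
    · have := hUc.tendsto 0
      rw [hU0] at this
      exact this.mono_left nhdsWithin_le_nhds
    · have : Tendsto (fun r : ℝ => r ^ n * b D r) (𝓝 0) (𝓝 (0 ^ n * b D 0)) :=
        Continuous.tendsto (by fun_prop) 0
      rw [zero_pow hn, zero_mul] at this
      exact this.mono_left nhdsWithin_le_nhds
    · have := hbder r (hsub r hr)
      rwa [max_eq_right (hUpos r (Ioo_subset_Icc_self (hsub r hr))).le] at this
  have hexp : 0 < (critExp n p - 1) * (1 / (p - 1)) - 1 := by
    have := lt_critExp hp1 hpn
    rw [sub_pos, mul_one_div, one_lt_div hpos1]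
    linarith
  obtain ⟨δ, hδ, hδD⟩ : ∃ δ ∈ Ioc 0 D, 0 < U δ R := by
    have hlim : Tendsto (fun d : ℝ => R * (R * M) ^ (1 / (p - 1)) *
        d ^ ((critExp n p - 1) * (1 / (p - 1)) - 1)) (𝓝[>] 0) (𝓝 0) := by
      have h1 := ((Real.continuousAt_rpow_const 0 _ (Or.inr hexp.le)).const_mul
        (R * (R * M) ^ (1 / (p - 1)))).tendsto
      rw [Real.zero_rpow hexp.ne', mul_zero] at h1
      exact h1.mono_left nhdsWithin_le_nhds
    obtain ⟨δ, hδ1, hδ2⟩ := ((hlim.eventually_lt_const one_pos).and (Ioc_mem_nhdsGT hD0)).exists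
    refine ⟨δ, hδ2, ?_⟩
    obtain ⟨hUc, hbc, hU0, hb0, hder, hbder⟩ := hfam δ hδ2
    obtain ⟨r, hr, hrd⟩ := exists_hasDerivAt_eq_slope (U δ)
      (fun r => -(r * b δ r) ^ (1 / (p - 1))) hR hUc.continuousOn
      (fun t ht => (hder t (Ioo_subset_Icc_self ht)).2.2)
    rw [sub_zero, hU0, eq_div_iff hR.ne'] at hrd
    obtain ⟨hbp, hble, -⟩ := hder r (Ioo_subset_Icc_self hr)
    have hδ0 := hδ2.1
    have hr0 := hr.1
    have h1 : (r * b δ r) ^ (1 / (p - 1)) ≤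
        (R * M) ^ (1 / (p - 1)) * δ ^ ((critExp n p - 1) * (1 / (p - 1))) := by
      rw [Real.rpow_mul hδ0.le, ← Real.mul_rpow (by positivity) (by positivity), mul_assoc]
      have := hr.2.le
      gcongr
    have h2 : δ ^ ((critExp n p - 1) * (1 / (p - 1))) =
        δ * δ ^ ((critExp n p - 1) * (1 / (p - 1)) - 1) := by
      rw [Real.rpow_sub_one hδ0.ne']; field_simp
    rw [h2] at h1
    have h3 := mul_le_mul_of_nonneg_left h1 hR.le
    have h4 := mul_lt_mul_of_pos_left hδ1 hδ0
    linarith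
  obtain ⟨d, hd, hdR⟩ := intermediate_value_Icc' hδ.2 hUR.continuousOn ⟨hDR, hδD.le⟩
  have hd' : d ∈ Ioc 0 D := ⟨hδ.1.trans_le hd.1, hd.2⟩
  obtain ⟨hUc, hbc, hU0, hb0, hder, hbder⟩ := hfam d hd'
  have hdR' : U d R = 0 := hdR
  have hUpos : ∀ r ∈ Ico 0 R, 0 < U d r := fun r hr =>
    hdR'.symm.trans_lt (hanti d hd' ⟨hr.1, hr.2.le⟩ ⟨hR.le, le_rfl⟩ hr.2)
  refine ⟨_, isPosRadialSolution_of_profile hp1 hp2 hUc hbc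
    (fun r hr => (hder r (Ico_subset_Icc_self hr)).1)
    (fun r hr => (hder r (Ico_subset_Icc_self hr)).2.2) (fun r hr => ?_) (by rw [hU0, hb0])
    hUpos hdR'⟩
  have := hbder r hr
  rwa [max_eq_right (hUpos r ⟨hr.1.le, hr.2⟩).le] at this

/-- For r ≤ 1 and ℓ ≥ ℓ* one has r^(ℓ-1) ≤ r^(ℓ*-1), so the threshold estimate covers every larger
ℓ. -/
theorem exists_radius_not_isPosRadialSolution {n : ℕ} {p : ℝ} (hp1 : 1 < p) (hpn : p < n)
    {K : ℝ → ℝ} (hK : Admissible K) {ℓ : ℝ} (hℓ : HasFlatness K ℓ)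
    (hle : flatThreshold n p ≤ ℓ) :
    ∃ R₀ : ℝ, 0 < R₀ ∧ ∀ R : ℝ, 0 < R → R < R₀ → ¬ ∃ u, IsPosRadialSolution n p K R u := by
  obtain ⟨A, M, c, C, ρ, hA, hM, hc, hC, hρ, hρ1, hb⟩ := hℓ.exists_bounds hK
  obtain ⟨R₁, hR₁, hmain⟩ :=
    RadialProfile.exists_radius_le_of_tendsto_zero hp1 hpn hA hM hC
  refine ⟨min ρ R₁, lt_min hρ hR₁, fun R hR hRlt ⟨u, hu⟩ => ?_⟩
  obtain ⟨d, U, b, hprof, hUR⟩ := hu.exists_profile hp1 hpn hR fun r hr => hK.pos r hr.1.le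
  have hb' := fun r (hr : r ∈ Ioo 0 R) =>
    hb r ⟨hr.1, hr.2.trans (hRlt.trans_le (min_le_left _ _))⟩
  refine absurd (hmain hprof hR (fun r hr => (hb' r hr).1) (fun r hr => (hb' r hr).2.1)
    (fun r hr => (hb' r hr).2.2.1) (fun r hr => ?_) (fun r hr => ?_) hUR)
    (not_le.2 (hRlt.trans_le (min_le_right _ _)))
  · have := hr.1
    exact le_trans (by positivity) (hb' r hr).2.2.2.1
  · refine (hb' r hr).2.2.2.2.trans (mul_le_mul_of_nonneg_left ?_ hC.le)
    refine Real.rpow_le_rpow_of_exponent_ge hr.1 ?_ (by linarith)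
    exact hr.2.le.trans (hRlt.le.trans ((min_le_left _ _).trans hρ1))

end PLaplace

end

theorem theorem1 (n : ℕ) (p : ℝ) (hp1 : 1 < p) (hpn : p < n)
    (hp_low : 2 * (n : ℝ) / (n + 2) ≤ p) (hp2 : p ≤ 2)
    (K : ℝ → ℝ) (hK : PLaplace.Admissible K)
    (ℓ : ℝ) (hℓ : PLaplace.HasFlatness K ℓ) :
    (ℓ < PLaplace.flatThreshold n p →
      ∀ R : ℝ, 0 < R → ∃ u, PLaplace.IsPosRadialSolution n p K R u) ∧
    (PLaplace.flatThreshold n p ≤ ℓ →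
      ∃ R₀ : ℝ, 0 < R₀ ∧ ∀ R : ℝ, 0 < R → R < R₀ →
        ¬ ∃ u, PLaplace.IsPosRadialSolution n p K R u) := by
  -- The lower bound on p is equivalent to q ≥ 2.
  have hq2 : 2 ≤ PLaplace.critExp n p := by
    unfold PLaplace.critExp
    rw [div_le_iff₀ (by positivity)] at hp_low
    rw [le_div_iff₀ (by linarith)]
    linarith
  exact ⟨fun hlt R hR => PLaplace.exists_isPosRadialSolution hp1 hpn hq2 hp2 hK hℓ hlt hR,
    fun hle => PLaplace.exists_radius_not_isPosRadialSolution hp1 hpn hK hℓ hle⟩
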